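/- **Setting.** A wireless network is a finite set $V$ of nodes at distinct points of the plane, with distinct (linearly ordered) IDs and a sink $v_s\in V$. A set of simultaneously active links (sender, receiver) is interference-free under the model $\mathcal M$ if: - *PrIM* with interference range $\rho\ge 1$: every link has length at most $1$, and for any two distinct links $(u,v),(u',v')$ we have $\|u'-v\|>\rho$; - *RTS/CTS* (interference range equal to the transmission range $1$): every link has length at most $1$, and for any two distinct links $(u,v),(u',v')$ we have $\|u'-u\|>1$ and $\|u'-v\|>1$; - *PhIM* with power $P>0$, noise $N_0>0$, threshold $\beta>0$, path loss exponent $\kappa>2$: no receiver is a sender, and for every link $(u,v)$, $P\|u-v\|^{-\kappa}\big/\big(N_0+\sum_{w\ne u}P\|w-v\|^{-\kappa}\big)\ge\beta$, where $w$ runs over the other active senders. The communication graph $G$ joins nodes at distance at most $1$ (PrIM, RTS/CTS), respectively at most $\delta r$ with $r=(P/(N_0\beta))^{1/\kappa}$ and a fixed $\delta\in[1/2,1)$ (the reduced communication graph, PhIM). $G$ is assumed connected, and $R$ is its radius measured from the sink, i.e. the largest hop distance of a node from $v_s$. There are finitely many periodic data collection queries. For query $i$, each node of $S_i\subseteq V$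 generates a data unit at each of the times $a_i+t p_i$, $t=0,1,2,\dots$ ($a_i\ge 0$, $p_i>0$). Sending it over one link takes time $\chi_i>0$, and it has to be at the sink by $a_i+tp_i+d_i$. A schedule (a set of timed transmissions) is valid if nodes send only data units which they have generated or completely received, one at a time, and the active links are interference-free at all times. The queries are schedulable if some valid schedule meets all deadlines. **Coloring.** Let $\lambda=\rho+1,\ 2,\ r$ under PrIM, RTS/CTS, PhIM, and partition the plane into the half-open squares $g_{i,j}$ (regions) of side $\lambda$, where $g_{i,j}$ has color $(i \bmod K)K+(j\bmod K)$. Let $K(\mathcal M)$ be the least $K\ge 1$ such that activating at most one sender in each region of one color, with receivers anywhere within communication range, is always interference-free, and let $c_2(\mathcal M)=K(\mathcal M)^2$. Let $c_3(\mathcal M)=8(\rho+4)^2,\ 200,\ 200$ under PrIM, RTS/CTS, PhIM. **Algorithm**, with a parameter $T>0$, $T>p_i$ for all $i$. 1. *Routing.* Rank nodes by (hop distance from $v_s$, ID). The dominators are the maximal independent set of $G$ found greedily by rank. In a spanning tree rooted at $v_s$, each dominator other than $v_s$ is joined to a parent one hop closer to $v_s$ (its connector), each connector to a neighboring dominator of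 smaller rank, and each remaining node to any neighboring dominator. Dominators and connectors form the CDS. The routing tree of query $i$ arises by pruning all nodes $u$ whose subtree $T^u$ contains no node of $S_i$. 2. *Plans and loads.* A node transmits its own data units and all data units it receives, so its relay load is $\mathcal L(u)=\sum_i |S_i\cap T^u|\,\chi_i/p_i$. The load $\mathcal L(g)$ of a region is the sum over its nodes. 3. *Time assignment.* Time, starting at $0$, is divided into cycles of length $c_2(\mathcal M)T$, in which the colors are active one after the other for time $T$ each. While a region $g$ is active, its nodes have consecutive slots of lengths $T\mathcal L(u)/\mathcal L(g)$, in the order of IDs. 4. *Rate-monotonic packet scheduling.* At the beginning of its slot a node orders the packets in its buffer: previous instances before current ones, then by shorter period, then by query ID, then first-in-first-out. It sends them to its parent in this order, each one completely, as long as they fit into the slot. **Theorem.** Suppose that $$\sum_i \frac{|S_i|\,\chi_i}{p_i}\le\frac{0.69}{c_2(\mathcal M)\,c_3(\mathcal M)}\qquad\text{and}\qquad d_i\ge 2\,c_2(\mathcal M)\,T\,R\ \text{ for all } i .$$ Then the queries are schedulable by the algorithm: a tree as in step 1 exists, and for every such tree the transmissions made by the algorithm form a valid (in particular interference-free) schedule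 which brings every data unit of every instance of every query to the sink by its deadline. In particular, the set of queries is schedulable. Moreover the coloring with $K(\mathcal M)^2$ colors has the required non-interference property (so that $c_2(\mathcal M)$ is finite), and $c_2(\mathcal M)=4$ under PrIM and RTS/CTS. -/

import Mathlib

namespace WSN

noncomputable section

open scoped Classical

/-! ## Interference models -/

/-- The plane in which the sensor nodes are placed. -/
abbrev Plane := EuclideanSpace ℝ (Fin 2)

/-- The three interference models. Under `prim` and `rtscts` the transmission range is `1`.
* `prim ρ`: protocol interference model with interference range `ρ`;
* `rtscts`: RTS/CTS model, interference range equal to the transmission range `1`;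
* `phim P N₀ β κ δ`: physical (SINR) model with common transmission power `P`, background noise
  `N₀`, SINR threshold `β` and path loss exponent `κ`; the algorithm works in the reduced
  communication graph, whose links have length at most `δ` times the maximum transmission
  radius. -/
inductive InterferenceModel
  | prim (ρ : ℝ)
  | rtscts
  | phim (P N₀ β κ δ : ℝ)

namespace InterferenceModel

/-- Standing assumptions on the parameters. -/
def Valid : InterferenceModel → Prop
  | prim ρ => 1 ≤ ρ
  | rtscts => True
  | phim P N₀ β κ δ => 0 < P ∧ 0 < N₀ ∧ 0 < β ∧ 2 < κ ∧ 1 / 2 ≤ δ ∧ δ < 1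

/-- The maximum transmission radius `r = (P / (N₀ β)) ^ (1 / κ)` of the physical model. -/
def maxRadius (P N₀ β κ : ℝ) : ℝ := (P / (N₀ * β)) ^ (1 / κ)

/-- Maximum length of a link of the (reduced) communication graph. -/
def range : InterferenceModel → ℝ
  | prim _ => 1
  | rtscts => 1
  | phim P N₀ β κ δ => δ * maxRadius P N₀ β κ

/-- The interference-aware radius `λ(M)`: the side length of the interference-aware regions. -/
def awareRadius : InterferenceModel → ℝ
  | prim ρ => ρ + 1
  | rtscts => 2
  | phim P N₀ β κ _ => maxRadius P N₀ β κ

/-- Signal to interference plus noise ratio at `v` of the signal sent by `u`, when `X` is the set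
of all concurrent senders. -/
def sinr (P N₀ κ : ℝ) (X : Finset Plane) (u v : Plane) : ℝ :=
  P * dist u v ^ (-κ) / (N₀ + ∑ w ∈ X.erase u, P * dist w v ^ (-κ))

/-- The links of `A` (pairs of a sender and a receiver position) can all transmit successfully at
the same time. -/
def InterferenceFree (A : Finset (Plane × Plane)) : InterferenceModel → Prop
  | prim ρ => ∀ a ∈ A, dist a.1 a.2 ≤ 1 ∧ ∀ b ∈ A, b ≠ a → ρ < dist b.1 a.2
  | rtscts => ∀ a ∈ A, dist a.1 a.2 ≤ 1 ∧
      ∀ b ∈ A, b ≠ a → 1 < dist b.1 a.1 ∧ 1 < dist b.1 a.2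
  | phim P N₀ β κ _ => ∀ a ∈ A, a.2 ∉ A.image Prod.fst ∧
      β ≤ sinr P N₀ κ (A.image Prod.fst) a.1 a.2

/-- Index `(i, j)` of the interference-aware region
`[i λ, (i + 1) λ) × [j λ, (j + 1) λ)` that contains `x`. -/
def region (M : InterferenceModel) (x : Plane) : ℤ × ℤ :=
  (⌊x 0 / M.awareRadius⌋, ⌊x 1 / M.awareRadius⌋)

/-- Color of a region in the coloring with `K * K` colors `0, …, K * K - 1`. -/
def regionColor (K : ℕ) (g : ℤ × ℤ) : ℕ :=
  ((g.1 % (K : ℤ)) * K + g.2 % (K : ℤ)).toNat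

/-- Whenever at most one node of each region of one common color is selected to transmit, to a
receiver anywhere within communication range, there is no interference. -/
def SafeColoring (M : InterferenceModel) (K : ℕ) : Prop :=
  ∀ A : Finset (Plane × Plane),
    (∀ a ∈ A, a.1 ≠ a.2 ∧ dist a.1 a.2 ≤ M.range) →
    (∀ a ∈ A, ∀ b ∈ A, regionColor K (M.region a.1) = regionColor K (M.region b.1)) →
    (∀ a ∈ A, ∀ b ∈ A, M.region a.1 = M.region b.1 → a = b) →
    M.InterferenceFree A

/-- `K(M)`: the least positive `K` for which the region coloring avoids interference. -/
def colorPeriod (M : InterferenceModel) : ℕ :=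
  sInf {K : ℕ | 0 < K ∧ M.SafeColoring K}

/-- `c₂(M) = K(M)²`: the number of colors of the region coloring. -/
def c₂ (M : InterferenceModel) : ℕ := M.colorPeriod ^ 2

/-- `c₃(M)`: the bound on the number of CDS nodes in an interference-aware region, plus one. -/
def c₃ : InterferenceModel → ℝ
  | prim ρ => 8 * (ρ + 4) ^ 2
  | rtscts => 200
  | phim _ _ _ _ _ => 200

end InterferenceModel

/-! ## Networks, queries, schedules -/

/-- Sensor nodes at distinct points of the plane, one of which is the sink. -/
structure Network (V : Type*) where
  pos : V → Plane
  pos_injective : Function.Injective pos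
  sink : V

/-- A periodic data collection query: its source nodes, the time `χ` needed to transmit one data
unit over a link, its period `p`, initial release time `a`, and relative deadline `d`. -/
structure Query (V : Type*) where
  sources : Finset V
  χ : ℝ
  p : ℝ
  a : ℝ
  d : ℝ
  χ_pos : 0 < χ
  p_pos : 0 < p
  a_nonneg : 0 ≤ a

/-- A data unit, named by the query, the source node and the instance number `0, 1, 2, …`. -/
structure Packet (V ι : Type*) where
  query : ι
  source : V
  inst : ℕ

/-- The transmission of a packet over a link, beginning at time `start`. -/
structure Transmission (V ι : Type*) where
  packet : Packet V ι
  sender : V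
  receiver : V
  start : ℝ

section

variable {V ι : Type*}

/-- The (reduced) communication graph. -/
def Network.graph (N : Network V) (M : InterferenceModel) : SimpleGraph V where
  Adj u v := u ≠ v ∧ dist (N.pos u) (N.pos v) ≤ M.range
  symm := ⟨fun _ _ h => ⟨h.1.symm, by rw [dist_comm]; exact h.2⟩⟩
  loopless := ⟨fun _ h => h.1 rfl⟩

/-- The radius `R` of the communication graph: the maximum hop distance from the sink. -/
def Network.radius [Fintype V] (N : Network V) (M : InterferenceModel) : ℕ :=
  Finset.univ.sup fun v => (N.graph M).dist N.sink v

/-- Time needed to transmit the packet over a link. -/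
def Packet.χ (Q : ι → Query V) (q : Packet V ι) : ℝ := (Q q.query).χ

/-- The time at which the packet is generated at its source. -/
def Packet.release (Q : ι → Query V) (q : Packet V ι) : ℝ :=
  (Q q.query).a + q.inst * (Q q.query).p

/-- The time by which the packet has to be at the sink. -/
def Packet.deadline (Q : ι → Query V) (q : Packet V ι) : ℝ :=
  q.release Q + (Q q.query).d

/-- The packet is really generated: its source is a source of its query. -/
def Packet.IsData (Q : ι → Query V) (q : Packet V ι) : Prop :=
  q.source ∈ (Q q.query).sources

/-- The time at which a transmission ends. -/
def Transmission.finish (Q : ι → Query V) (x : Transmission V ι) : ℝ :=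
  x.start + x.packet.χ Q

/-- Links, as pairs of positions, over which the schedule `S` transmits at time `t`. -/
def activeLinks [Fintype V] (N : Network V) (Q : ι → Query V) (S : Set (Transmission V ι))
    (t : ℝ) : Finset (Plane × Plane) :=
  (Finset.univ.filter fun e : V × V =>
    ∃ x ∈ S, x.sender = e.1 ∧ x.receiver = e.2 ∧ x.start ≤ t ∧ t < x.finish Q).image
      fun e => (N.pos e.1, N.pos e.2)

/-- `S` is a valid schedule of transmissions: a node sends only data units which it has generated
or completely received before, one at a time, and transmissions never interfere. -/
structure IsSchedule [Fintype V] (M : InterferenceModel) (N : Network V) (Q : ι → Query V)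
    (S : Set (Transmission V ι)) : Prop where
  causal : ∀ x ∈ S, x.packet.IsData Q ∧
    ((x.sender = x.packet.source ∧ x.packet.release Q ≤ x.start) ∨
      ∃ y ∈ S, y.packet = x.packet ∧ y.receiver = x.sender ∧ y.finish Q ≤ x.start)
  sequential : ∀ x ∈ S, ∀ y ∈ S, x ≠ y → x.sender = y.sender →
    x.finish Q ≤ y.start ∨ y.finish Q ≤ x.start
  interferenceFree : ∀ t : ℝ, M.InterferenceFree (activeLinks N Q S t)

/-- Every data unit of every instance of every query is at the sink by its deadline. -/
def MeetsDeadlines (N : Network V) (Q : ι → Query V) (S : Set (Transmission V ι)) : Prop :=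
  ∀ q : Packet V ι, q.IsData Q →
    (q.source = N.sink ∧ q.release Q ≤ q.deadline Q) ∨
      ∃ x ∈ S, x.packet = q ∧ x.receiver = N.sink ∧ x.finish Q ≤ q.deadline Q

/-- `S` answers all queries in time. -/
def AnswersAll [Fintype V] (M : InterferenceModel) (N : Network V) (Q : ι → Query V)
    (S : Set (Transmission V ι)) : Prop :=
  IsSchedule M N Q S ∧ MeetsDeadlines N Q S

/-- The set of queries can be answered in time by some routing and scheduling. -/
def Schedulable [Fintype V] (M : InterferenceModel) (N : Network V) (Q : ι → Query V) : Prop :=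
  ∃ S : Set (Transmission V ι), AnswersAll M N Q S

/-! ## Phase 1: routing trees based on a connected dominating set -/

/-- Rank of a node: hop distance from the sink first, node ID (the linear order of `V`) second. -/
def rank [LinearOrder V] (G : SimpleGraph V) (s v : V) : ℕ ×ₗ V := toLex (G.dist s v, v)

/-- Connectors: the parents of the dominators other than the sink. -/
def connectors (s : V) (D : Finset V) (par : V → V) : Finset V := (D.erase s).image par

/-- `par` (with `par s = s`) is the parent map of a spanning tree `T_G` rooted at the sink `s` and
based on the connected dominating set `D ∪ connectors s D par`:
* the set `D` of dominators is the maximal independent set found greedily in the order of rank;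
* a dominator is connected to a parent in a breadth-first search tree (its connector), a connector
  to a neighboring dominator of smaller rank, any other node to a neighboring dominator. -/
structure IsCDSTree [LinearOrder V] (G : SimpleGraph V) (s : V) (D : Finset V) (par : V → V) :
    Prop where
  mem_dominators_iff : ∀ v, v ∈ D ↔ ∀ u, G.Adj u v → rank G s u < rank G s v → u ∉ D
  par_sink : par s = s
  par_dominator : ∀ u ∈ D, u ≠ s → G.Adj u (par u) ∧ G.dist s (par u) + 1 = G.dist s u
  par_connector : ∀ u ∈ connectors s D par, rank G s (par u) < rank G s u
  par_dominatee : ∀ u, u ∉ D → G.Adj u (par u) ∧ par u ∈ D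

/-- Hop distance of `v` from the root in the tree. -/
def depth (s : V) (par : V → V) (v : V) : ℕ := sInf {n | par^[n] v = s}

/-- `c` is a child of `u` in the tree (the root, although `par s = s`, is nobody's child). -/
def IsChild (s : V) (par : V → V) (c u : V) : Prop :=
  par c = u ∧ depth s par c = depth s par u + 1

/-- The subtree of `T_G` rooted at `u`. -/
def subtree [Fintype V] (par : V → V) (u : V) : Finset V :=
  Finset.univ.filter fun v => ∃ n, par^[n] v = u

/-- The nodes of the routing tree of the `i`-th query, which is obtained from `T_G` by pruning
every node whose subtree contains no source. -/
def routingTree [Fintype V] (Q : ι → Query V) (par : V → V) (i : ι) : Finset V :=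
  Finset.univ.filter fun u => ((Q i).sources ∩ subtree par u).Nonempty

/-! ## Phases 2 and 3: relay loads and the assignment of time to the nodes -/

/-- Relay load of a node: the load of all the data units, its own and the relayed ones, that the
node has in its transmission plan. -/
def relayLoad [Fintype V] [Fintype ι] (Q : ι → Query V) (par : V → V) (u : V) : ℝ :=
  ∑ i ∈ Finset.univ.filter fun i => u ∈ routingTree Q par i,
    (((Q i).sources ∩ subtree par u).card : ℝ) * (Q i).χ / (Q i).p

/-- Relay load of a region. -/
def regionLoad [Fintype V] [Fintype ι] (M : InterferenceModel) (N : Network V) (Q : ι → Query V)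
    (par : V → V) (g : ℤ × ℤ) : ℝ :=
  ∑ u ∈ Finset.univ.filter fun u => M.region (N.pos u) = g, relayLoad Q par u

/-- Linear time assignment: the transmission time of a node in each active period, of length `T`,
of its region. -/
def slotLength [Fintype V] [Fintype ι] (M : InterferenceModel) (N : Network V) (Q : ι → Query V)
    (T : ℝ) (par : V → V) (u : V) : ℝ :=
  T * (relayLoad Q par u / regionLoad M N Q par (M.region (N.pos u)))

/-- The beginning of the slot of `u` in the `k`-th cycle. A cycle has length `c₂ * T`; in its
course the colors are active one after the other, each for the time `T`, and the nodes of an active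
region have their slots one after the other in the order of their IDs. -/
def slotStart [Fintype V] [LinearOrder V] [Fintype ι] (M : InterferenceModel) (N : Network V)
    (Q : ι → Query V) (T : ℝ) (par : V → V) (u : V) (k : ℕ) : ℝ :=
  ((k : ℝ) * M.c₂ + InterferenceModel.regionColor M.colorPeriod (M.region (N.pos u))) * T +
    ∑ w ∈ Finset.univ.filter fun w => M.region (N.pos w) = M.region (N.pos u) ∧ w < u,
      slotLength M N Q T par w

/-! ## Phase 4: rate-monotonic packet scheduling -/

section

variable [LinearOrder V] [LinearOrder ι]

/-- Priority of a packet at time `t` (a smaller value is a higher priority): packets of previous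
instances come before those of current instances, then the period decides, then the ID of the
query, then the time `arr q` of arrival at the node (first-in-first-out). The remaining entries
only break ties. -/
def priority (Q : ι → Query V) (arr : Packet V ι → EReal) (t : ℝ) (q : Packet V ι) :
    Bool ×ₗ ℝ ×ₗ ι ×ₗ EReal ×ₗ ℕ ×ₗ V :=
  toLex (decide (t < q.release Q + (Q q.query).p),
    toLex ((Q q.query).p, toLex (q.query, toLex (arr q, toLex (q.inst, q.source)))))

/-- The packets which have arrived by time `t` and are not in the set `done` of those already
sent. -/
def buffer (arr : Packet V ι → EReal) (done : Set (Packet V ι)) (t : ℝ) : Set (Packet V ι) :=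
  {q | arr q ≤ (t : EReal) ∧ q ∉ done}

/-- Total transmission time of `q` and of all packets of higher priority in the buffer, at the
beginning `t` of a slot. -/
def workUpTo (Q : ι → Query V) (arr : Packet V ι → EReal) (done : Set (Packet V ι)) (t : ℝ)
    (q : Packet V ι) : ℝ :=
  ∑ᶠ r ∈ {r | r ∈ buffer arr done t ∧ priority Q arr t r ≤ priority Q arr t q}, r.χ Q

/-- Packets sent in a slot of length `len` beginning at `t`: the packets of the buffer are sent in
the order of priority, one after the other, as long as they fit into the slot. -/
def sentInSlot (Q : ι → Query V) (arr : Packet V ι → EReal) (len t : ℝ)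
    (done : Set (Packet V ι)) : Set (Packet V ι) :=
  {q | q ∈ buffer arr done t ∧ workUpTo Q arr done t q ≤ len}

/-- The packets a node has sent before its `k`-th slot, when its slots have length `len` and begin
at the times `start 0, start 1, …`, and packets arrive at the times `arr`. -/
def sentBefore (Q : ι → Query V) (arr : Packet V ι → EReal) (len : ℝ) (start : ℕ → ℝ) :
    ℕ → Set (Packet V ι)
  | 0 => ∅
  | k + 1 => sentBefore Q arr len start k ∪
      sentInSlot Q arr len (start k) (sentBefore Q arr len start k)

/-- The node sends the packet `q` in its `k`-th slot, and is done with it at time `τ`. -/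
def SendsAt (Q : ι → Query V) (arr : Packet V ι → EReal) (len : ℝ) (start : ℕ → ℝ)
    (q : Packet V ι) (k : ℕ) (τ : ℝ) : Prop :=
  q ∈ sentInSlot Q arr len (start k) (sentBefore Q arr len start k) ∧
    τ = start k + workUpTo Q arr (sentBefore Q arr len start k) (start k) q

/-- The time at which the node is done with sending `q` (`⊤` if it never sends `q`). -/
def finishTime (Q : ι → Query V) (arr : Packet V ι → EReal) (len : ℝ) (start : ℕ → ℝ)
    (q : Packet V ι) : EReal :=
  ⨅ (k : ℕ) (τ : ℝ) (_ : SendsAt Q arr len start q k τ), (τ : EReal)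

variable [Fintype V] [Fintype ι]

/-- The time at which the packet `q` is available at the node `u` (`⊤` if never): its release time
at its source, and the time at which a child is done with sending it to `u` at any other node. -/
def arrival (M : InterferenceModel) (N : Network V) (Q : ι → Query V) (T : ℝ) (par : V → V)
    (u : V) : Packet V ι → EReal := fun q =>
  if q.source = u ∧ q.IsData Q then (q.release Q : EReal)
  else ⨅ (c : V) (_ : IsChild N.sink par c u),
    finishTime Q (arrival M N Q T par c) (slotLength M N Q T par c)
      (slotStart M N Q T par c) q
termination_by Finset.univ.sup (depth N.sink par) - depth N.sink par u
decreasing_by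
  have h1 := (‹IsChild N.sink par c u›).2
  have h2 : depth N.sink par c ≤ Finset.univ.sup (depth N.sink par) :=
    Finset.le_sup (Finset.mem_univ c)
  omega

/-- The transmissions made by the four-phase algorithm. -/
def algorithmSchedule (M : InterferenceModel) (N : Network V) (Q : ι → Query V) (T : ℝ)
    (par : V → V) : Set (Transmission V ι) :=
  {x | x.sender ≠ N.sink ∧ x.receiver = par x.sender ∧
    ∃ k, SendsAt Q (arrival M N Q T par x.sender) (slotLength M N Q T par x.sender)
      (slotStart M N Q T par x.sender) x.packet k (x.finish Q)}

end

end

end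

end WSN

namespace WSN

open scoped Classical

namespace InterferenceModel

/-! ## Interference-aware regions -/

/-! The argument has three ingredients.

Interference. Regions of one color are so far apart that one sender per region is harmless
(`Valid.colorPeriod_spec`): by the triangle inequality under PrIM and RTS/CTS, by the convergence of
`∑ ‖z‖ ^ (-κ)` over `ℤ²` for `κ > 2` under PhIM. Slots that overlap in time belong to one cycle and
one color, and within a region the slots are disjoint.

Capacity. Let `W` be the total load. Dominators are pairwise farther apart than the communication
range, so a region holds at most `c₃ - 1` CDS nodes, each relaying at most `W`; all other nodes are
leaves, with load at most `W` altogether. A region thus has load at most `c₃ * W ≤ 0.69 / c₂`. As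
`c₂ ≥ 4`, the slot of `u` has length at least `(c₂ + 1) * T * relayLoad u`
(`IsCDSTree.work_le_slotLength`): the work of one cycle, of length `c₂ * T`, plus one spare data
unit per source and query, which costs at most a further `T` since `p < T`.

Delay. By induction from the leaves (`IsCDSTree.arrivesInStep`), the data units of a fixed source
and query that reach `u` between consecutive slots were released within a window of one cycle. Hence
each slot empties the buffer, whatever the priorities, and each hop costs at most one cycle. The
tree has depth at most `2 * R - 1`, because two hops bring a dominator at least one hop closer to
the sink; initial waiting and the last slot fit into the `2 * R` cycles granted. -/

theorem maxRadius_pos {P N₀ β κ : ℝ} (hP : 0 < P) (hN : 0 < N₀) (hβ : 0 < β) :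
    0 < maxRadius P N₀ β κ :=
  Real.rpow_pos_of_pos (div_pos hP (mul_pos hN hβ)) _

/-- The radius is chosen so that, without interference, the SINR at distance `r` is exactly `β`. -/
theorem maxRadius_rpow_neg {P N₀ β κ : ℝ} (hP : 0 < P) (hN : 0 < N₀) (hβ : 0 < β)
    (hκ : κ ≠ 0) : P * maxRadius P N₀ β κ ^ (-κ) = N₀ * β := by
  have h : 0 < P / (N₀ * β) := div_pos hP (mul_pos hN hβ)
  rw [maxRadius, ← Real.rpow_mul h.le, one_div, mul_neg, inv_mul_cancel₀ hκ, Real.rpow_neg_one]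
  field_simp

theorem Valid.range_pos {M : InterferenceModel} (hM : M.Valid) : 0 < M.range := by
  cases M with
  | prim ρ => exact one_pos
  | rtscts => exact one_pos
  | phim P N₀ β κ δ =>
    obtain ⟨hP, hN, hβ, -, hδ, -⟩ := hM
    exact mul_pos (by linarith) (maxRadius_pos hP hN hβ)

theorem Valid.range_le_awareRadius {M : InterferenceModel} (hM : M.Valid) :
    M.range ≤ M.awareRadius := by
  cases M with
  | prim ρ =>
    have : (1 : ℝ) ≤ ρ := hM
    simp only [range, awareRadius]
    linarith
  | rtscts => norm_num [range, awareRadius]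
  | phim P N₀ β κ δ =>
    obtain ⟨hP, hN, hβ, -, hδ, hδ1⟩ := hM
    exact mul_le_of_le_one_left (maxRadius_pos hP hN hβ).le hδ1.le

theorem Valid.awareRadius_pos {M : InterferenceModel} (hM : M.Valid) : 0 < M.awareRadius :=
  hM.range_pos.trans_le hM.range_le_awareRadius

/-- Under every model a node cannot receive while it sends. -/
theorem InterferenceFree.sender_ne_receiver {M : InterferenceModel} (hM : M.Valid)
    {A : Finset (Plane × Plane)} (h : M.InterferenceFree A) {a b : Plane × Plane}
    (ha : a ∈ A) (hb : b ∈ A) (hab : b ≠ a) : b.1 ≠ a.2 := by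
  intro he
  cases M with
  | prim ρ =>
    have h1 : (1 : ℝ) ≤ ρ := hM
    have := (h a ha).2 b hb hab
    rw [he, dist_self] at this
    linarith
  | rtscts =>
    have := ((h a ha).2 b hb hab).2
    rw [he, dist_self] at this
    linarith
  | phim P N₀ β κ δ =>
    exact (h a ha).1 (he ▸ Finset.mem_image_of_mem _ hb)

theorem regionColor_lt {K : ℕ} (hK : 0 < K) (g : ℤ × ℤ) : regionColor K g < K ^ 2 := by
  have hK' : (0 : ℤ) < K := by exact_mod_cast hK
  have h1 := Int.emod_lt_of_pos g.1 hK'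
  have h2 := Int.emod_lt_of_pos g.2 hK'
  have h3 := Int.emod_nonneg g.1 hK'.ne'
  have h4 := Int.emod_nonneg g.2 hK'.ne'
  have h5 : (0 : ℤ) < (K : ℤ) ^ 2 := by positivity
  rw [regionColor, Int.toNat_lt' (by positivity)]
  push_cast
  nlinarith

theorem regionColor_eq_iff {K : ℕ} (hK : 0 < K) (g h : ℤ × ℤ) :
    regionColor K g = regionColor K h ↔
      g.1 % (K : ℤ) = h.1 % (K : ℤ) ∧ g.2 % (K : ℤ) = h.2 % (K : ℤ) := by
  have hK' : (0 : ℤ) < K := by exact_mod_cast hK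
  refine ⟨fun e => ?_, fun ⟨e1, e2⟩ => by rw [regionColor, regionColor, e1, e2]⟩
  have n (x : ℤ × ℤ) : 0 ≤ x.1 % (K : ℤ) * K + x.2 % (K : ℤ) :=
    add_nonneg (mul_nonneg (Int.emod_nonneg _ hK'.ne') hK'.le) (Int.emod_nonneg _ hK'.ne')
  have e' : g.1 % (K : ℤ) * K + g.2 % (K : ℤ) = h.1 % (K : ℤ) * K + h.2 % (K : ℤ) := by
    have := congrArg (fun m : ℕ => (m : ℤ)) e
    simpa only [regionColor, Int.toNat_of_nonneg (n g), Int.toNat_of_nonneg (n h)] using this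
  have e2 : g.2 % (K : ℤ) = h.2 % (K : ℤ) := by
    simpa [Int.add_emod, Int.mul_emod] using congrArg (· % (K : ℤ)) e'
  refine ⟨?_, e2⟩
  rw [e2] at e'
  exact mul_right_cancel₀ hK'.ne' (add_right_cancel e')

/-- Regions of one color differ by a multiple of the period of the coloring. -/
theorem exists_of_regionColor_eq {K : ℕ} (hK : 0 < K) {g h : ℤ × ℤ}
    (e : regionColor K g = regionColor K h) :
    ∃ z : Fin 2 → ℤ, g.1 = h.1 + K * z 0 ∧ g.2 = h.2 + K * z 1 := by
  obtain ⟨e1, e2⟩ := (regionColor_eq_iff hK g h).1 e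
  obtain ⟨a, ha⟩ := (Int.ModEq.symm e1).dvd
  obtain ⟨b, hb⟩ := (Int.ModEq.symm e2).dvd
  exact ⟨![a, b], by simp; omega, by simp; omega⟩

theorem abs_sub_le_dist (x y : Plane) (j : Fin 2) : |x j - y j| ≤ dist x y := by
  rw [dist_eq_norm]
  exact PiLp.norm_apply_le (x - y) j

theorem abs_floor_sub_lt (a b : ℝ) : (|⌊a⌋ - ⌊b⌋| : ℝ) < |a - b| + 1 := by
  have h1 := Int.floor_le a
  have h2 := Int.floor_le b
  have h3 := Int.lt_floor_add_one a
  have h4 := Int.lt_floor_add_one b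
  rcases abs_cases ((⌊a⌋ : ℝ) - ⌊b⌋) with h | h <;> rcases abs_cases (a - b) with h' | h' <;>
    linarith

/-- If the indices of two squares differ by `m` in some coordinate, then `m - 1` full squares lie
between them in that direction. The sup norm of `z` picks the best coordinate. -/
theorem lt_dist_of_region_eq {M : InterferenceModel} (hM : M.Valid) {K : ℕ} {x y : Plane}
    {z : Fin 2 → ℤ} (h0 : (M.region x).1 = (M.region y).1 + K * z 0)
    (h1 : (M.region x).2 = (M.region y).2 + K * z 1) :
    (K * ‖z‖ - 1) * M.awareRadius < dist x y := by
  have hr := hM.awareRadius_pos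
  have key (j : Fin 2) : (K * ‖z j‖ - 1) * M.awareRadius < dist x y := by
    have e : ⌊x j / M.awareRadius⌋ - ⌊y j / M.awareRadius⌋ = K * z j := by
      fin_cases j <;> simp [region] at h0 h1 ⊢ <;> omega
    have h := abs_floor_sub_lt (x j / M.awareRadius) (y j / M.awareRadius)
    have e' : (⌊x j / M.awareRadius⌋ - ⌊y j / M.awareRadius⌋ : ℝ) = K * z j := by
      exact_mod_cast e
    rw [e', abs_mul, Nat.abs_cast, ← sub_div, abs_div, abs_of_pos hr, ← sub_lt_iff_lt_add,
      lt_div_iff₀ hr] at h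
    rw [Int.norm_eq_abs]
    exact h.trans_le (abs_sub_le_dist x y j)
  obtain ⟨j, hj⟩ : ∃ j, ‖z‖ = ‖z j‖ := by
    obtain ⟨j, hj⟩ := Finite.exists_max fun j => ‖z j‖
    exact ⟨j, le_antisymm ((pi_norm_le_iff_of_nonneg (norm_nonneg _)).2 hj) (norm_le_pi_norm z j)⟩
  rw [hj]
  exact key j

theorem one_le_norm {z : Fin 2 → ℤ} (hz : z ≠ 0) : 1 ≤ ‖z‖ := by
  obtain ⟨j, hj⟩ := Function.ne_iff.1 hz
  refine le_trans ?_ (norm_le_pi_norm z j)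
  rw [Int.norm_eq_abs]
  exact_mod_cast Int.one_le_abs hj

/-! ## The region coloring avoids interference -/

/-- With one color, two nodes within range on opposite sides of a region border may send to each
other, so each receives while sending. This yields `c₂ ≥ 4`, needed for the exact value `4` and for
the slack in the slot lengths. -/
theorem not_safeColoring_one {M : InterferenceModel} (hM : M.Valid) : ¬ M.SafeColoring 1 := by
  intro h
  have hr := hM.range_pos
  have hl := hM.awareRadius_pos
  have hrl := hM.range_le_awareRadius
  let u : Plane := !₂[M.awareRadius - M.range, 0]
  let v : Plane := !₂[M.awareRadius, 0]
  have hu : M.region u = (0, 0) := by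
    have : ⌊(M.awareRadius - M.range) / M.awareRadius⌋ = 0 := by
      rw [Int.floor_eq_zero_iff]
      exact ⟨div_nonneg (by linarith) hl.le, by rw [div_lt_one hl]; linarith⟩
    simp [region, u, this]
  have hv : M.region v = (1, 0) := by
    simp [region, v, hl.ne']
  have huv : u ≠ v := fun e => by simp [e, hv] at hu
  have hd : dist u v = M.range := by
    rw [EuclideanSpace.dist_eq]
    simp [u, v, Real.dist_eq, Real.sqrt_sq hr.le]
  have hI := h {(u, v), (v, u)} (by
      intro a ha
      simp only [Finset.mem_insert, Finset.mem_singleton] at ha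
      rcases ha with rfl | rfl
      · exact ⟨huv, hd.le⟩
      · exact ⟨huv.symm, (dist_comm v u).trans_le hd.le⟩)
    (by simp [regionColor]) (by
      intro a ha b hb
      simp only [Finset.mem_insert, Finset.mem_singleton] at ha hb
      rcases ha with rfl | rfl <;> rcases hb with rfl | rfl <;> simp [hu, hv])
  exact hI.sender_ne_receiver hM (a := (u, v)) (b := (v, u)) (by simp) (by simp)
    (fun e => huv (congrArg Prod.snd e)) rfl

/-- In a set of links from different regions of one color, the sender of another link is far
from the sender of a given one. -/
theorem exists_lt_dist {M : InterferenceModel} (hM : M.Valid) {K : ℕ} (hK : 0 < K) {x y : Plane}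
    (hc : regionColor K (M.region x) = regionColor K (M.region y))
    (hne : M.region x ≠ M.region y) :
    ∃ z : Fin 2 → ℤ, z ≠ 0 ∧ (M.region x).1 = (M.region y).1 + K * z 0 ∧
      (M.region x).2 = (M.region y).2 + K * z 1 ∧
      (K * ‖z‖ - 1) * M.awareRadius < dist x y := by
  obtain ⟨z, h0, h1⟩ := exists_of_regionColor_eq hK hc
  refine ⟨z, ?_, h0, h1, lt_dist_of_region_eq hM h0 h1⟩
  rintro rfl
  exact hne (Prod.ext (by simpa using h0) (by simpa using h1))

theorem awareRadius_lt_dist {M : InterferenceModel} (hM : M.Valid) {x y : Plane}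
    (hc : regionColor 2 (M.region x) = regionColor 2 (M.region y))
    (hne : M.region x ≠ M.region y) : M.awareRadius < dist x y := by
  obtain ⟨z, hz, -, -, h⟩ := exists_lt_dist hM two_pos hc hne
  have := one_le_norm hz
  have hr := hM.awareRadius_pos
  push_cast at h
  nlinarith

/-- Senders in different regions of one color are more than `ρ + 1` apart, and a receiver is within
`1` of its sender. -/
theorem safeColoring_two_prim {ρ : ℝ} (hρ : 1 ≤ ρ) : (prim ρ).SafeColoring 2 := by
  intro A h1 h2 h3 a ha
  refine ⟨(h1 a ha).2, fun b hb hba => ?_⟩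
  have h := awareRadius_lt_dist (M := prim ρ) hρ (h2 b hb a ha) fun e => hba (h3 b hb a ha e)
  have h' := dist_triangle_right b.1 a.1 a.2
  have h'' := (h1 a ha).2
  simp only [awareRadius, range] at h h''
  linarith

theorem safeColoring_two_rtscts : rtscts.SafeColoring 2 := by
  intro A h1 h2 h3 a ha
  refine ⟨(h1 a ha).2, fun b hb hba => ?_⟩
  have h := awareRadius_lt_dist (M := rtscts) trivial (h2 b hb a ha) fun e => hba (h3 b hb a ha e)
  have h' := dist_triangle_right b.1 a.1 a.2
  have h'' := (h1 a ha).2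
  simp only [awareRadius, range] at h h''
  constructor <;> linarith

/-- Relative to a fixed sender, the other senders occupy distinct nonzero points of a lattice of
mesh `K * r`. Their total interference is at most a constant times `K ^ (-κ)`, while `δ < 1` leaves
a fixed amount to spare. -/
theorem exists_safeColoring_phim {P N₀ β κ δ : ℝ} (hM : (phim P N₀ β κ δ).Valid) :
    ∃ K, 0 < K ∧ (phim P N₀ β κ δ).SafeColoring K := by
  obtain ⟨hP, hN, hβ, hκ, hδ, hδ1⟩ := id hM
  have hκ0 : 0 < κ := by linarith
  set r := maxRadius P N₀ β κ with hr
  have hr0 : 0 < r := maxRadius_pos hP hN hβ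
  have hsum : Summable fun z : Fin 2 → ℤ => ‖z‖ ^ (-κ) :=
    EisensteinSeries.summable_one_div_norm_rpow hκ
  set B := ∑' z : Fin 2 → ℤ, ‖z‖ ^ (-κ)
  -- The interference budget: at distance at most `δ * r` the signal is at least `δ ^ (-κ) * N₀ *
  -- β`, which tolerates interference up to `N₀ * (δ ^ (-κ) - 1)`.
  have hgap : 0 < N₀ * (δ ^ (-κ) - 1) := by
    have := Real.one_lt_rpow_of_pos_of_lt_one_of_neg (by linarith : 0 < δ) hδ1
      (by linarith : -κ < 0)
    exact mul_pos hN (by linarith)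
  have hlim : Filter.Tendsto (fun K : ℕ => P * ((K * (r / 2)) ^ (-κ) * B)) Filter.atTop
      (nhds 0) := by
    have h1 : Filter.Tendsto (fun K : ℕ => (K : ℝ) * (r / 2)) Filter.atTop Filter.atTop :=
      tendsto_natCast_atTop_atTop.atTop_mul_const (by positivity)
    simpa using (((tendsto_rpow_neg_atTop hκ0).comp h1).mul_const B).const_mul P
  obtain ⟨K, hKgap, hK4⟩ :=
    ((hlim.eventually_lt_const hgap).and (Filter.eventually_ge_atTop 4)).exists
  have hK : 0 < K := by omega
  have hK4' : (4 : ℝ) ≤ K := by exact_mod_cast hK4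
  refine ⟨K, hK, fun A h1 h2 h3 a ha => ?_⟩
  set X := A.image Prod.fst
  have hd : dist a.1 a.2 ≤ δ * r := (h1 a ha).2
  have hd0 : 0 < dist a.1 a.2 := dist_pos.2 (h1 a ha).1
  have hdr : dist a.1 a.2 ≤ r := hd.trans (by nlinarith)
  have hex (w : Plane) (hw : w ∈ X.erase a.1) : ∃ z : Fin 2 → ℤ, z ≠ 0 ∧
      (region (phim P N₀ β κ δ) w).1 = (region (phim P N₀ β κ δ) a.1).1 + K * z 0 ∧
      (region (phim P N₀ β κ δ) w).2 = (region (phim P N₀ β κ δ) a.1).2 + K * z 1 ∧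
      (K * (r / 2)) * ‖z‖ ≤ dist w a.2 := by
    obtain ⟨hwa, hwX⟩ := Finset.mem_erase.1 hw
    obtain ⟨b, hb, rfl⟩ := Finset.mem_image.1 hwX
    obtain ⟨z, hz, hz0, hz1, hlt⟩ := exists_lt_dist hM hK (h2 b hb a ha)
      fun e => hwa (congrArg Prod.fst (h3 b hb a ha e))
    refine ⟨z, hz, hz0, hz1, ?_⟩
    have h' := dist_triangle_right b.1 a.1 a.2
    have hz' := one_le_norm hz
    change (K * ‖z‖ - 1) * r < _ at hlt
    -- From `4 ≤ K * ‖z‖` follows `K * ‖z‖ - 2 ≥ K * ‖z‖ / 2`; the `2` accounts for the side of a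
    -- region and for the distance from sender to receiver, each at most `r`.
    have h4 : 4 ≤ K * ‖z‖ := by nlinarith
    nlinarith
  choose! z hz using hex
  -- One sender per region makes the offsets distinct, so the sum over senders is part of the
  -- lattice sum.
  have hzinj : Set.InjOn z (X.erase a.1) := by
    intro w hw w' hw' e
    obtain ⟨-, e0, e1, -⟩ := hz w hw
    obtain ⟨-, e0', e1', -⟩ := hz w' hw'
    obtain ⟨b, hb, rfl⟩ := Finset.mem_image.1 (Finset.mem_of_mem_erase hw)
    obtain ⟨b', hb', rfl⟩ := Finset.mem_image.1 (Finset.mem_of_mem_erase hw')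
    rw [e] at e0 e1
    exact congrArg Prod.fst (h3 b hb b' hb' (Prod.ext (e0.trans e0'.symm) (e1.trans e1'.symm)))
  have hpos (w : Plane) (hw : w ∈ X.erase a.1) : 0 < K * (r / 2) * ‖z w‖ := by
    have := one_le_norm (hz w hw).1
    positivity
  refine ⟨fun hmem => ?_, ?_⟩
  · have hmem' : a.2 ∈ X.erase a.1 := Finset.mem_erase.2 ⟨(h1 a ha).1.symm, hmem⟩
    have := (hpos _ hmem').trans_le (hz _ hmem').2.2.2
    rw [dist_self] at this
    exact lt_irrefl _ this
  · have hI : ∑ w ∈ X.erase a.1, P * dist w a.2 ^ (-κ) ≤ N₀ * (δ ^ (-κ) - 1) := by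
      refine le_trans ?_ hKgap.le
      rw [← Finset.mul_sum]
      refine mul_le_mul_of_nonneg_left ?_ hP.le
      calc ∑ w ∈ X.erase a.1, dist w a.2 ^ (-κ)
          ≤ ∑ w ∈ X.erase a.1, (K * (r / 2)) ^ (-κ) * ‖z w‖ ^ (-κ) := by
            refine Finset.sum_le_sum fun w hw => ?_
            rw [← Real.mul_rpow (by positivity) (norm_nonneg _)]
            exact Real.rpow_le_rpow_of_nonpos (hpos w hw) (hz w hw).2.2.2 (by linarith)
        _ = (K * (r / 2)) ^ (-κ) * ∑ x ∈ (X.erase a.1).image z, ‖x‖ ^ (-κ) := by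
            rw [← Finset.mul_sum, Finset.sum_image hzinj]
        _ ≤ (K * (r / 2)) ^ (-κ) * B := by
            refine mul_le_mul_of_nonneg_left ?_ (by positivity)
            exact hsum.sum_le_tsum _ fun x _ => by positivity
    have hI0 : 0 ≤ ∑ w ∈ X.erase a.1, P * dist w a.2 ^ (-κ) :=
      Finset.sum_nonneg fun w _ => by positivity
    rw [sinr, le_div_iff₀ (by linarith)]
    calc β * (N₀ + ∑ w ∈ X.erase a.1, P * dist w a.2 ^ (-κ))
        ≤ β * (N₀ + N₀ * (δ ^ (-κ) - 1)) := by gcongr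
      _ = δ ^ (-κ) * (N₀ * β) := by ring
      _ = P * (δ * r) ^ (-κ) := by
          rw [← maxRadius_rpow_neg hP hN hβ hκ0.ne', Real.mul_rpow (by linarith) hr0.le]
          ring
      _ ≤ P * dist a.1 a.2 ^ (-κ) := by
          refine mul_le_mul_of_nonneg_left ?_ hP.le
          exact Real.rpow_le_rpow_of_nonpos hd0 hd (by linarith)

theorem Valid.colorPeriod_spec {M : InterferenceModel} (hM : M.Valid) :
    0 < M.colorPeriod ∧ M.SafeColoring M.colorPeriod := by
  refine Nat.sInf_mem (s := {K : ℕ | 0 < K ∧ M.SafeColoring K}) ?_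
  cases M with
  | prim ρ => exact ⟨2, two_pos, safeColoring_two_prim hM⟩
  | rtscts => exact ⟨2, two_pos, safeColoring_two_rtscts⟩
  | phim P N₀ β κ δ => exact exists_safeColoring_phim hM

theorem Valid.two_le_colorPeriod {M : InterferenceModel} (hM : M.Valid) : 2 ≤ M.colorPeriod := by
  obtain ⟨h0, h1⟩ := hM.colorPeriod_spec
  by_contra! h
  have : M.colorPeriod = 1 := by omega
  exact not_safeColoring_one hM (this ▸ h1)

theorem Valid.four_le_c₂ {M : InterferenceModel} (hM : M.Valid) : 4 ≤ M.c₂ :=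
  Nat.pow_le_pow_left hM.two_le_colorPeriod 2

theorem Valid.c₂_eq_four {M : InterferenceModel} (hM : M.Valid) (h : M.SafeColoring 2) :
    M.c₂ = 4 := by
  have h1 : M.colorPeriod ≤ 2 := Nat.sInf_le ⟨two_pos, h⟩
  simp [c₂, le_antisymm h1 hM.two_le_colorPeriod]

end InterferenceModel

/-! ## Trees given by parent maps -/

section Tree

variable {V : Type*} {s : V} {par : V → V}

theorem iterate_depth (hreach : ∀ u, ∃ n, par^[n] u = s) (u : V) :
    par^[depth s par u] u = s :=
  Nat.sInf_mem (s := {n | par^[n] u = s}) (hreach u)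

theorem depth_le {u : V} {n : ℕ} (h : par^[n] u = s) : depth s par u ≤ n :=
  Nat.sInf_le h

theorem depth_root : depth s par s = 0 :=
  Nat.le_zero.1 (depth_le rfl)

theorem depth_eq_par_add_one (hreach : ∀ u, ∃ n, par^[n] u = s) {u : V} (hu : u ≠ s) :
    depth s par u = depth s par (par u) + 1 := by
  apply le_antisymm
  · exact depth_le (by rw [Function.iterate_succ_apply]; exact iterate_depth hreach _)
  · have h := iterate_depth hreach u
    cases hd : depth s par u with
    | zero => rw [hd] at h; exact absurd h hu
    | succ n =>
      rw [hd, Function.iterate_succ_apply] at h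
      exact Nat.succ_le_succ (depth_le h)

theorem isChild_par (hreach : ∀ u, ∃ n, par^[n] u = s) {u : V} (hu : u ≠ s) :
    IsChild s par u (par u) :=
  ⟨rfl, depth_eq_par_add_one hreach hu⟩

theorem IsChild.ne_root {c u : V} (h : IsChild s par c u) : c ≠ s := by
  rintro rfl
  have := h.2
  rw [depth_root] at this
  omega

theorem depth_iterate_le (hreach : ∀ u, ∃ n, par^[n] u = s) (hs : par s = s) (n : ℕ) (u : V) :
    depth s par (par^[n] u) ≤ depth s par u := by
  induction n generalizing u with
  | zero => rfl
  | succ n ih =>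
    rw [Function.iterate_succ_apply]
    refine (ih _).trans ?_
    by_cases hu : u = s
    · rw [hu, hs]
    · exact (depth_eq_par_add_one hreach hu).symm ▸ Nat.le_succ _

variable [Fintype V]

theorem mem_subtree {u v : V} : v ∈ subtree par u ↔ ∃ n, par^[n] v = u := by
  simp [subtree]

theorem mem_subtree_self (u : V) : u ∈ subtree par u := mem_subtree.2 ⟨0, rfl⟩

theorem IsChild.subtree_subset {c u : V} (h : IsChild s par c u) :
    subtree par c ⊆ subtree par u := by
  intro v hv
  obtain ⟨n, hn⟩ := mem_subtree.1 hv
  exact mem_subtree.2 ⟨n + 1, by rw [Function.iterate_succ_apply', hn, h.1]⟩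

theorem depth_le_of_mem_subtree (hreach : ∀ u, ∃ n, par^[n] u = s) (hs : par s = s) {u v : V}
    (h : v ∈ subtree par u) : depth s par u ≤ depth s par v := by
  obtain ⟨n, rfl⟩ := mem_subtree.1 h
  exact depth_iterate_le hreach hs n v

theorem exists_child_of_mem_subtree (hs : par s = s) (hreach : ∀ u, ∃ n, par^[n] u = s)
    {u v : V} (h : v ∈ subtree par u) (hne : v ≠ u) :
    ∃ c, IsChild s par c u ∧ v ∈ subtree par c := by
  have h' := mem_subtree.1 h
  have hn := Nat.find_spec h'
  cases hf : Nat.find h' with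
  | zero => rw [hf] at hn; exact absurd hn hne
  | succ n =>
    rw [hf, Function.iterate_succ_apply'] at hn
    refine ⟨par^[n] v, ?_, mem_subtree.2 ⟨n, rfl⟩⟩
    -- Since the root is its own parent, reaching it after `n` steps would give `u = s` already at
    -- `n`, against minimality.
    have hc : par^[n] v ≠ s := by
      intro hc
      have h2 : par^[n] v = u := by rw [← hn, hc, hs]
      have := Nat.find_min' h' h2
      omega
    have := isChild_par hreach hc
    rwa [hn] at this

/-- Both children are on the path from `v` to the root. If one came strictly after the other, it
would be an iterated parent of `u`, hence no deeper than `u`. -/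
theorem child_unique (hs : par s = s) (hreach : ∀ u, ∃ n, par^[n] u = s) {u v c c' : V}
    (hc : IsChild s par c u) (hc' : IsChild s par c' u) (hv : v ∈ subtree par c)
    (hv' : v ∈ subtree par c') : c = c' := by
  have key (c c' : V) (n m : ℕ) (hc : IsChild s par c u) (hc' : IsChild s par c' u)
      (hn : par^[n] v = c) (hm : par^[m] v = c') (hnm : n ≤ m) : c = c' := by
    obtain ⟨k, rfl⟩ := Nat.exists_eq_add_of_le hnm
    rw [add_comm, Function.iterate_add_apply, hn] at hm
    cases k with
    | zero => exact hm
    | succ k =>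
      rw [Function.iterate_succ_apply, hc.1] at hm
      have := depth_iterate_le hreach hs k u
      rw [hm, hc'.2] at this
      omega
  obtain ⟨n, hn⟩ := mem_subtree.1 hv
  obtain ⟨m, hm⟩ := mem_subtree.1 hv'
  rcases le_total n m with h | h
  · exact key c c' n m hc hc' hn hm h
  · exact (key c' c m n hc' hc hm hn h).symm

/-- Induction over the routing tree from the leaves to the root. -/
theorem child_induction {P : V → Prop}
    (step : ∀ u, (∀ c, IsChild s par c u → P c) → P u) (u : V) : P u := by
  suffices h : ∀ n u, Finset.univ.sup (depth s par) - depth s par u < n → P u from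
    h _ u (Nat.lt_succ_self _)
  intro n
  induction n with
  | zero => exact fun u h => absurd h (Nat.not_lt_zero _)
  | succ n ih =>
    refine fun u h => step u fun c hc => ih c ?_
    have h1 := hc.2
    have h2 : depth s par c ≤ Finset.univ.sup (depth s par) := Finset.le_sup (Finset.mem_univ c)
    omega

end Tree

/-! ## Spanning trees based on a connected dominating set -/

section CDS

theorem mem_connectors {V : Type*} {s : V} {D : Finset V} {par : V → V} {u : V} :
    u ∈ connectors s D par ↔ ∃ d ∈ D, d ≠ s ∧ par d = u := by
  simp [connectors, and_assoc, and_left_comm]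

theorem par_mem_connectors {V : Type*} {s : V} {D : Finset V} {par : V → V} {u : V}
    (hu : u ∈ D) (hus : u ≠ s) : par u ∈ connectors s D par :=
  mem_connectors.2 ⟨u, hu, hus, rfl⟩

theorem exists_adj_dist_add_one {V : Type*} {G : SimpleGraph V} {s : V} (hG : G.Connected)
    {u : V} (hu : u ≠ s) :
    ∃ w, G.Adj u w ∧ G.dist s w + 1 = G.dist s u := by
  obtain ⟨p, hp⟩ := hG.exists_walk_length_eq_dist u s
  cases p with
  | nil => exact absurd rfl hu
  | @cons _ w _ h p =>
    refine ⟨w, h, ?_⟩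
    have h1 := SimpleGraph.dist_le p
    have h2 := hG.dist_triangle (u := u) (v := w) (w := s)
    rw [SimpleGraph.dist_eq_one_iff_adj.2 h] at h2
    rw [SimpleGraph.Walk.length_cons] at hp
    rw [SimpleGraph.dist_comm (u := s) (v := w), SimpleGraph.dist_comm (u := s) (v := u)]
    omega

variable {V : Type*} [LinearOrder V] {G : SimpleGraph V} {s : V} {D : Finset V} {par : V → V}

theorem rank_injective : Function.Injective (rank G s) := fun _ _ h =>
  congrArg (fun x => (ofLex x).2) h

theorem rank_lt_of_dist_lt {u v : V} (h : G.dist s u < G.dist s v) :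
    rank G s u < rank G s v :=
  Prod.Lex.toLex_lt_toLex.2 (Or.inl h)

theorem dist_le_of_rank_lt {u v : V} (h : rank G s u < rank G s v) :
    G.dist s u ≤ G.dist s v := by
  rcases Prod.Lex.toLex_lt_toLex.1 h with h | h
  · exact h.le
  · exact h.1.le

theorem wellFounded_rank [Finite V] (G : SimpleGraph V) (s : V) :
    WellFounded fun u v => rank G s u < rank G s v :=
  InvImage.wf (rank G s) wellFounded_lt

/-- The maximal independent set found greedily in the order of rank. -/
theorem exists_dominators [Fintype V] (G : SimpleGraph V) (s : V) :
    ∃ D : Finset V, ∀ v, v ∈ D ↔ ∀ u, G.Adj u v → rank G s u < rank G s v → u ∉ D := by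
  -- Well-founded recursion along the rank: a node is chosen unless a neighbor of smaller rank has
  -- been chosen.
  let P : V → Prop := (wellFounded_rank G s).fix fun v ih =>
    ∀ u, G.Adj u v → ∀ h : rank G s u < rank G s v, ¬ ih u h
  have hP (v : V) : P v ↔ ∀ u, G.Adj u v → rank G s u < rank G s v → ¬ P u :=
    iff_of_eq (WellFounded.fix_eq _ _ v)
  exact ⟨Finset.univ.filter P, fun v => by simpa using hP v⟩

/-- The sink is the only node at hop distance `0`, so none of its neighbors precedes it in rank. -/
theorem sink_mem_of_greedy (hG : G.Connected)
    (hD : ∀ v, v ∈ D ↔ ∀ u, G.Adj u v → rank G s u < rank G s v → u ∉ D) : s ∈ D := by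
  rw [hD]
  intro u hu hlt
  have h := dist_le_of_rank_lt hlt
  rw [SimpleGraph.dist_self, Nat.le_zero, hG.dist_eq_zero_iff] at h
  exact absurd (h ▸ hu) (G.loopless.irrefl _)

theorem exists_isCDSTree [Fintype V] (hG : G.Connected) (s : V) :
    ∃ D par, IsCDSTree G s D par := by
  obtain ⟨D, hD⟩ := exists_dominators G s
  have hs := sink_mem_of_greedy hG hD
  have h1 (u : V) : ∃ w, (u = s → w = s) ∧
      (u ∈ D → u ≠ s → G.Adj u w ∧ G.dist s w + 1 = G.dist s u) ∧
      (u ∉ D → G.Adj u w ∧ w ∈ D ∧ rank G s w < rank G s u) := by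
    by_cases hu : u ∈ D
    · by_cases hus : u = s
      · exact ⟨s, fun _ => rfl, fun _ h => absurd hus h, fun h => absurd hu h⟩
      · obtain ⟨w, hw⟩ := exists_adj_dist_add_one hG hus
        exact ⟨w, fun h => absurd h hus, fun _ _ => hw, fun h => absurd hu h⟩
    · have h := mt (hD u).2 hu
      push Not at h
      obtain ⟨w, hw, hlt, hwD⟩ := h
      exact ⟨w, fun h => absurd (h ▸ hs) hu, fun h => absurd h hu, fun _ => ⟨hw.symm, hwD, hlt⟩⟩
  choose par hpar using h1
  refine ⟨D, par, hD, (hpar s).1 rfl, fun u => (hpar u).2.1, fun u hu => ?_,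
    fun u hu => ⟨((hpar u).2.2 hu).1, ((hpar u).2.2 hu).2.1⟩⟩
  obtain ⟨d, hdD, hds, rfl⟩ := mem_connectors.1 hu
  obtain ⟨hadj, hdist⟩ := (hpar d).2.1 hdD hds
  exact ((hpar _).2.2 ((hD d).1 hdD _ hadj.symm (rank_lt_of_dist_lt (by omega)))).2.2

namespace IsCDSTree

theorem sink_mem (h : IsCDSTree G s D par) (hG : G.Connected) : s ∈ D :=
  sink_mem_of_greedy hG h.mem_dominators_iff

theorem par_not_mem (h : IsCDSTree G s D par) {u : V} (hu : u ∈ D) (hus : u ≠ s) :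
    par u ∉ D := by
  obtain ⟨hadj, hdist⟩ := h.par_dominator u hu hus
  exact (h.mem_dominators_iff u).1 hu _ hadj.symm (rank_lt_of_dist_lt (by omega))

theorem not_adj (h : IsCDSTree G s D par) {u v : V} (hu : u ∈ D) (hv : v ∈ D) : ¬ G.Adj u v := by
  intro hadj
  rcases lt_trichotomy (rank G s u) (rank G s v) with hlt | heq | hlt
  · exact (h.mem_dominators_iff v).1 hv u hadj hlt hu
  · exact hadj.ne (rank_injective heq)
  · exact (h.mem_dominators_iff u).1 hu v hadj.symm hlt hv

theorem adj_par (h : IsCDSTree G s D par) {u : V} (hu : u ≠ s) : G.Adj u (par u) := by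
  by_cases huD : u ∈ D
  · exact (h.par_dominator u huD hu).1
  · exact (h.par_dominatee u huD).1

/-- Two hops in the tree bring a dominator one hop closer to the sink. -/
theorem exists_iterate_dominator [Finite V] (h : IsCDSTree G s D par) (hG : G.Connected) (u : V)
    (hu : u ∈ D) (hus : u ≠ s) : ∃ n, par^[n] u = s ∧ n + 2 ≤ 2 * G.dist s u := by
  induction u using (wellFounded_rank G s).induction with
  | _ u ih =>
    obtain ⟨hadj, hdist⟩ := h.par_dominator u hu hus
    have h1 := h.par_connector (par u) (par_mem_connectors hu hus)
    have h2 := (h.par_dominatee (par u) (h.par_not_mem hu hus)).2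
    have h3 := dist_le_of_rank_lt h1
    by_cases hs : par (par u) = s
    -- The witness `2` requires `G.dist s u ≥ 2`. This holds because the connector `par u` is not a
    -- dominator, hence not the sink.
    · refine ⟨2, hs, ?_⟩
      have : par u ≠ s := fun e => h.par_not_mem hu hus (e ▸ h.sink_mem hG)
      have := mt (hG.dist_eq_zero_iff (u := s) (v := par u)).1 this.symm
      omega
    · obtain ⟨n, hn, hle⟩ := ih (par (par u)) (h1.trans (rank_lt_of_dist_lt (by omega))) h2 hs
      exact ⟨n + 2, hn, by omega⟩

theorem exists_iterate [Fintype V] (h : IsCDSTree G s D par) (hG : G.Connected) (u : V)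
    (hus : u ≠ s) :
    ∃ n, par^[n] u = s ∧ n + 1 ≤ 2 * Finset.univ.sup fun v => G.dist s v := by
  have hR (v : V) : G.dist s v ≤ Finset.univ.sup fun v => G.dist s v :=
    Finset.le_sup (f := fun v => G.dist s v) (Finset.mem_univ v)
  by_cases hu : u ∈ D
  · obtain ⟨n, hn, hle⟩ := h.exists_iterate_dominator hG u hu hus
    exact ⟨n, hn, by have := hR u; omega⟩
  · by_cases hp : par u = s
    · refine ⟨1, hp, ?_⟩
      have := mt (hG.dist_eq_zero_iff (u := s) (v := u)).1 hus.symm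
      have := hR u
      omega
    · obtain ⟨n, hn, hle⟩ := h.exists_iterate_dominator hG _ (h.par_dominatee u hu).2 hp
      exact ⟨n + 1, hn, by have := hR (par u); omega⟩

theorem reaches_sink [Fintype V] (h : IsCDSTree G s D par) (hG : G.Connected) (u : V) :
    ∃ n, par^[n] u = s := by
  by_cases hus : u = s
  · exact ⟨0, hus⟩
  · exact (h.exists_iterate hG u hus).imp fun _ => And.left

theorem depth_add_one_le [Fintype V] (h : IsCDSTree G s D par) (hG : G.Connected) {u : V}
    (hus : u ≠ s) : depth s par u + 1 ≤ 2 * Finset.univ.sup fun v => G.dist s v := by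
  obtain ⟨n, hn, hle⟩ := h.exists_iterate hG u hus
  have := depth_le hn
  omega

/-- The nodes outside the connected dominating set are leaves. -/
theorem subtree_eq_singleton [Fintype V] (h : IsCDSTree G s D par) (hG : G.Connected) {u : V}
    (hu : u ∉ D) (hc : u ∉ connectors s D par) : subtree par u = {u} := by
  ext v
  rw [mem_subtree, Finset.mem_singleton]
  refine ⟨?_, fun e => ⟨0, e⟩⟩
  rintro ⟨n, hn⟩
  cases n with
  | zero => exact hn
  | succ n =>
    exfalso
    rw [Function.iterate_succ_apply'] at hn
    by_cases hw : par^[n] v ∈ D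
    · by_cases hs : par^[n] v = s
      · rw [hs, h.par_sink] at hn
        exact hu (hn ▸ h.sink_mem hG)
      · exact hc (hn ▸ par_mem_connectors hw hs)
    · exact hu (hn ▸ (h.par_dominatee _ hw).2)

end IsCDSTree

end CDS

/-! ## Packing: the connected dominating set is sparse -/

/-- A square of side `2 / 3 * r` has diagonal less than `r`, as `2 * (2 / 3) ^ 2 = 8 / 9 < 1`. -/
theorem dist_lt_of_abs_sub_lt {x y : Plane} {r : ℝ} (hr : 0 < r)
    (h : ∀ j, |x j - y j| < 2 / 3 * r) : dist x y < r := by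
  have hj (j : Fin 2) : (x j - y j) ^ 2 < (2 / 3 * r) ^ 2 := by
    rw [← sq_abs]
    exact pow_lt_pow_left₀ (h j) (abs_nonneg _) two_ne_zero
  rw [EuclideanSpace.dist_eq, Real.sqrt_lt' hr, Fin.sum_univ_two, Real.dist_eq, Real.dist_eq,
    sq_abs, sq_abs]
  nlinarith [hj 0, hj 1]

/-- Points of a square of side `l` with mutual distances at least `r`. -/
theorem card_le_of_separated {V : Type*} {pos : V → Plane} {S : Finset V} {r l : ℝ} (hr : 0 < r)
    (hl : 0 ≤ l) (a : Fin 2 → ℝ) (hbox : ∀ v ∈ S, ∀ j, a j ≤ pos v j ∧ pos v j ≤ a j + l)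
    (hsep : ∀ v ∈ S, ∀ w ∈ S, v ≠ w → r ≤ dist (pos v) (pos w)) :
    (S.card : ℝ) ≤ (3 / 2 * (l / r) + 1) ^ 2 := by
  set b := 3 / 2 * (l / r)
  have hb : 0 ≤ b := by positivity
  let n := ⌊b⌋₊ + 1
  -- Indices of the grid cell, of side `2 / 3 * r`, that contains the point; a cell holds at most
  -- one point of `S`.
  let f (v : V) (j : Fin 2) : ℕ := ⌊3 / 2 * ((pos v j - a j) / r)⌋₊
  have hnn (v) (hv : v ∈ S) (j : Fin 2) : 0 ≤ 3 / 2 * ((pos v j - a j) / r) :=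
    mul_nonneg (by norm_num) (div_nonneg (by linarith [(hbox v hv j).1]) hr.le)
  have hmaps : ∀ v ∈ S, (f v 0, f v 1) ∈ Finset.range n ×ˢ Finset.range n := by
    intro v hv
    have hf (j : Fin 2) : f v j < n := by
      refine Nat.lt_succ_of_le (Nat.floor_le_floor ?_)
      have := (hbox v hv j).2
      simp only [b]
      gcongr
      linarith
    exact Finset.mem_product.2 ⟨Finset.mem_range.2 (hf 0), Finset.mem_range.2 (hf 1)⟩
  have hinj : Set.InjOn (fun v => (f v 0, f v 1)) S := by
    intro v hv w hw e
    by_contra hne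
    refine absurd (hsep v hv w hw hne) (not_le.2 (dist_lt_of_abs_sub_lt hr fun j => ?_))
    have he : f v j = f w j := by
      have e' := Prod.ext_iff.1 e
      fin_cases j
      · exact e'.1
      · exact e'.2
    have h1 := Nat.floor_le (hnn v hv j)
    have h2 := Nat.lt_floor_add_one (3 / 2 * ((pos v j - a j) / r))
    have h3 := Nat.floor_le (hnn w hw j)
    have h4 := Nat.lt_floor_add_one (3 / 2 * ((pos w j - a j) / r))
    change (f v j : ℝ) ≤ _ at h1
    change _ < (f v j : ℝ) + 1 at h2
    change (f w j : ℝ) ≤ _ at h3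
    change _ < (f w j : ℝ) + 1 at h4
    rw [he] at h1 h2
    have e1 (x : ℝ) : 3 / 2 * ((x - a j) / r) * (2 / 3 * r) = x - a j := by field_simp
    have hr' : 0 < 2 / 3 * r := by positivity
    have h5 := mul_lt_mul_of_pos_right (h2.trans_le (add_le_add_left h3 1)) hr'
    have h6 := mul_lt_mul_of_pos_right (h4.trans_le (add_le_add_left h1 1)) hr'
    rw [add_mul, e1, e1] at h5 h6
    rw [abs_lt]
    constructor <;> linarith
  have hcard : S.card ≤ n * n := by
    simpa using Finset.card_le_card_of_injOn _ hmaps hinj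
  have hn : (n : ℝ) ≤ b + 1 := by
    simp only [n]
    push_cast
    linarith [Nat.floor_le hb]
  calc (S.card : ℝ) ≤ n * n := by exact_mod_cast hcard
    _ ≤ (b + 1) ^ 2 := by rw [sq]; gcongr

namespace InterferenceModel

/-- The square bounds the number of dominators in a region enlarged by the range on every side. The
factor `2` accounts for the connectors, the final `1` for all leaves of the region together. Under
PhIM, `δ ≥ 1 / 2` gives `awareRadius ≤ 2 * range`. -/
theorem Valid.two_mul_sq_add_one_le_c₃ {M : InterferenceModel} (hM : M.Valid) :
    2 * (3 / 2 * ((M.awareRadius + 2 * M.range) / M.range) + 1) ^ 2 + 1 ≤ M.c₃ := by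
  have hr := hM.range_pos
  have key (h : M.awareRadius ≤ 2 * M.range) :
      2 * (3 / 2 * ((M.awareRadius + 2 * M.range) / M.range) + 1) ^ 2 + 1 ≤ 200 := by
    have h1 : (M.awareRadius + 2 * M.range) / M.range ≤ 4 := by
      rw [div_le_iff₀ hr]; linarith
    have h2 : 0 ≤ (M.awareRadius + 2 * M.range) / M.range :=
      div_nonneg (by linarith [hM.awareRadius_pos]) hr.le
    nlinarith
  cases M with
  | prim ρ =>
    have : (1 : ℝ) ≤ ρ := hM
    simp only [awareRadius, range, c₃, div_one]
    nlinarith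
  | rtscts => exact key (by norm_num [awareRadius, range])
  | phim P N₀ β κ δ =>
    obtain ⟨hP, hN, hβ, -, hδ, -⟩ := hM
    have := maxRadius_pos (κ := κ) hP hN hβ
    exact key (by simp only [awareRadius, range]; nlinarith)

theorem Valid.c₃_pos {M : InterferenceModel} (hM : M.Valid) : 0 < M.c₃ :=
  lt_of_lt_of_le (by positivity) hM.two_mul_sq_add_one_le_c₃

theorem mem_region_bounds {M : InterferenceModel} (hM : M.Valid) {x : Plane} {g : ℤ × ℤ}
    (h : M.region x = g) (j : Fin 2) :
    (![g.1, g.2] j : ℝ) * M.awareRadius ≤ x j ∧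
      x j ≤ (![g.1, g.2] j : ℝ) * M.awareRadius + M.awareRadius := by
  have hl := hM.awareRadius_pos
  have key (y : ℝ) : (⌊y / M.awareRadius⌋ : ℝ) * M.awareRadius ≤ y ∧
      y ≤ (⌊y / M.awareRadius⌋ : ℝ) * M.awareRadius + M.awareRadius := by
    have h1 := (le_div_iff₀ hl).1 (Int.floor_le (y / M.awareRadius))
    have h2 := ((div_lt_iff₀ hl).1 (Int.lt_floor_add_one (y / M.awareRadius))).le
    exact ⟨h1, by linarith⟩
  subst h
  fin_cases j
  · exact key (x 0)
  · exact key (x 1)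

end InterferenceModel

/-! ## Loads and lengths of slots -/

section Load

variable {V ι : Type*} [Fintype V] [Fintype ι] {M : InterferenceModel} {N : Network V}
  {par : V → V} {Q : ι → Query V} {T : ℝ}

/-- Queries whose tree was pruned at `u` contribute zero anyway. -/
theorem relayLoad_eq_sum (Q : ι → Query V) (par : V → V) (u : V) :
    relayLoad Q par u =
      ∑ i, (((Q i).sources ∩ subtree par u).card : ℝ) * (Q i).χ / (Q i).p := by
  refine Finset.sum_filter_of_ne fun i _ hi => ?_
  rw [routingTree, Finset.mem_filter]
  refine ⟨Finset.mem_univ _, Finset.card_pos.1 (Nat.pos_of_ne_zero fun h => hi ?_)⟩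
  simp [h]

theorem relayLoad_nonneg (Q : ι → Query V) (par : V → V) (u : V) : 0 ≤ relayLoad Q par u := by
  rw [relayLoad_eq_sum]
  exact Finset.sum_nonneg fun i _ => div_nonneg (mul_nonneg (Nat.cast_nonneg _) (Q i).χ_pos.le)
    (Q i).p_pos.le

theorem relayLoad_pos {i : ι} {u v : V} (hv : v ∈ (Q i).sources) (hu : v ∈ subtree par u) :
    0 < relayLoad Q par u := by
  rw [relayLoad_eq_sum]
  refine Finset.sum_pos' (fun i _ => div_nonneg (mul_nonneg (Nat.cast_nonneg _) (Q i).χ_pos.le)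
    (Q i).p_pos.le) ⟨i, Finset.mem_univ _, div_pos (mul_pos ?_ (Q i).χ_pos) (Q i).p_pos⟩
  exact Nat.cast_pos.2 (Finset.card_pos.2 ⟨v, Finset.mem_inter.2 ⟨hv, hu⟩⟩)

theorem relayLoad_le_total (Q : ι → Query V) (par : V → V) (u : V) :
    relayLoad Q par u ≤ ∑ i, ((Q i).sources.card : ℝ) * (Q i).χ / (Q i).p := by
  rw [relayLoad_eq_sum]
  refine Finset.sum_le_sum fun i _ => ?_
  have h1 := (Q i).χ_pos.le
  have h2 := (Q i).p_pos.le
  have h3 := Finset.card_le_card (Finset.inter_subset_left (s₁ := (Q i).sources)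
    (s₂ := subtree par u))
  gcongr

theorem regionLoad_nonneg (M : InterferenceModel) (N : Network V) (Q : ι → Query V)
    (par : V → V) (g : ℤ × ℤ) : 0 ≤ regionLoad M N Q par g :=
  Finset.sum_nonneg fun u _ => relayLoad_nonneg Q par u

theorem relayLoad_le_regionLoad (M : InterferenceModel) (N : Network V) (Q : ι → Query V)
    (par : V → V) (u : V) : relayLoad Q par u ≤ regionLoad M N Q par (M.region (N.pos u)) :=
  Finset.single_le_sum (f := relayLoad Q par) (fun u _ => relayLoad_nonneg Q par u)
    (Finset.mem_filter.2 ⟨Finset.mem_univ u, rfl⟩)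

/-- Leaves transmit their own data units only. -/
theorem sum_relayLoad_le_of_leaves (A : Finset V) (hA : ∀ u ∈ A, subtree par u = {u}) :
    ∑ u ∈ A, relayLoad Q par u ≤ ∑ i, ((Q i).sources.card : ℝ) * (Q i).χ / (Q i).p := by
  simp only [relayLoad_eq_sum]
  rw [Finset.sum_comm]
  refine Finset.sum_le_sum fun i _ => ?_
  have h1 := (Q i).χ_pos.le
  have h2 := (Q i).p_pos.le
  rw [← Finset.sum_div, ← Finset.sum_mul]
  gcongr
  have e : ∑ u ∈ A, (((Q i).sources ∩ subtree par u).card : ℝ) =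
      ((A.filter fun u => u ∈ (Q i).sources).card : ℝ) := by
    rw [Finset.card_filter, Nat.cast_sum]
    refine Finset.sum_congr rfl fun u hu => ?_
    rw [hA u hu]
    by_cases hus : u ∈ (Q i).sources <;> simp [hus]
  rw [e]
  exact_mod_cast Finset.card_le_card fun u hu => (Finset.mem_filter.1 hu).2

theorem slotLength_nonneg (hT : 0 ≤ T) (u : V) : 0 ≤ slotLength M N Q T par u :=
  mul_nonneg hT (div_nonneg (relayLoad_nonneg _ _ _) (regionLoad_nonneg _ _ _ _ _))

theorem slotLength_pos (hT : 0 < T) {u : V} (hu : 0 < relayLoad Q par u) :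
    0 < slotLength M N Q T par u :=
  mul_pos hT (div_pos hu (hu.trans_le (relayLoad_le_regionLoad M N Q par u)))

/-- The slots of the nodes of a region fit into its active period. -/
theorem sum_slotLength_le (hT : 0 ≤ T) (g : ℤ × ℤ) (A : Finset V)
    (hA : ∀ u ∈ A, M.region (N.pos u) = g) : ∑ u ∈ A, slotLength M N Q T par u ≤ T := by
  have e : ∑ u ∈ A, slotLength M N Q T par u =
      T * ((∑ u ∈ A, relayLoad Q par u) / regionLoad M N Q par g) := by
    rw [Finset.sum_div, Finset.mul_sum]
    exact Finset.sum_congr rfl fun u hu => by rw [slotLength, hA u hu]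
  rw [e]
  refine mul_le_of_le_one_right hT (div_le_one_of_le₀ ?_ (regionLoad_nonneg _ _ _ _ _))
  exact Finset.sum_le_sum_of_subset_of_nonneg
    (fun u hu => Finset.mem_filter.2 ⟨Finset.mem_univ _, hA u hu⟩)
    fun u _ _ => relayLoad_nonneg Q par u

theorem slotLength_le (hT : 0 ≤ T) (u : V) : slotLength M N Q T par u ≤ T := by
  simpa using sum_slotLength_le (M := M) (N := N) (Q := Q) (par := par) hT (M.region (N.pos u))
    {u} (by simp)

end Load

/-! ## Slots -/

/-- Regions of one color that contain neighbors are equal. -/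
theorem region_eq_of_adj {V : Type*} {M : InterferenceModel} {N : Network V} (hM : M.Valid)
    {u w : V} (hadj : (N.graph M).Adj u w)
    (hc : InterferenceModel.regionColor M.colorPeriod (M.region (N.pos u)) =
      InterferenceModel.regionColor M.colorPeriod (M.region (N.pos w))) :
    M.region (N.pos u) = M.region (N.pos w) := by
  by_contra hne
  -- Otherwise the coloring would allow the two neighbors to send to each other simultaneously.
  have hpos : N.pos u ≠ N.pos w := fun e => hadj.1 (N.pos_injective e)
  have hI := hM.colorPeriod_spec.2 {(N.pos u, N.pos w), (N.pos w, N.pos u)} (by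
      intro a ha
      simp only [Finset.mem_insert, Finset.mem_singleton] at ha
      rcases ha with rfl | rfl
      · exact ⟨hpos, hadj.2⟩
      · exact ⟨hpos.symm, hadj.symm.2⟩)
    (by
      intro a ha b hb
      simp only [Finset.mem_insert, Finset.mem_singleton] at ha hb
      rcases ha with rfl | rfl <;> rcases hb with rfl | rfl <;> simp [hc])
    (by
      intro a ha b hb
      simp only [Finset.mem_insert, Finset.mem_singleton] at ha hb
      rcases ha with rfl | rfl <;> rcases hb with rfl | rfl <;> simp [hne, Ne.symm hne])
  exact hI.sender_ne_receiver hM (a := (N.pos u, N.pos w)) (b := (N.pos w, N.pos u)) (by simp)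
    (by simp) (fun e => hpos (congrArg Prod.snd e)) rfl

section Slots

variable {V ι : Type*} [Fintype V] [LinearOrder V] [Fintype ι] {M : InterferenceModel}
  {N : Network V} {D : Finset V} {par : V → V} {Q : ι → Query V} {T : ℝ}

/-- Every connector is the parent of a dominator within range. So all CDS nodes of the region are
dominators of the enlarged square or parents of such. -/
theorem IsCDSTree.card_region_add_one_le (h : IsCDSTree (N.graph M) N.sink D par) (hM : M.Valid)
    (g : ℤ × ℤ) :
    ((Finset.univ.filter fun u => M.region (N.pos u) = g ∧
      (u ∈ D ∨ u ∈ connectors N.sink D par)).card : ℝ) + 1 ≤ M.c₃ := by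
  have hr := hM.range_pos
  have hl := hM.awareRadius_pos
  let a (j : Fin 2) : ℝ := (![g.1, g.2] j : ℝ) * M.awareRadius - M.range
  let S := D.filter fun v => ∀ j, a j ≤ N.pos v j ∧
    N.pos v j ≤ a j + (M.awareRadius + 2 * M.range)
  have hS : (S.card : ℝ) ≤ (3 / 2 * ((M.awareRadius + 2 * M.range) / M.range) + 1) ^ 2 := by
    refine card_le_of_separated hr (by linarith) a (fun v hv => (Finset.mem_filter.1 hv).2) ?_
    intro v hv w hw hne
    by_contra! hlt
    exact h.not_adj (Finset.mem_filter.1 hv).1 (Finset.mem_filter.1 hw).1 ⟨hne, hlt.le⟩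
  have hsub : (Finset.univ.filter fun u => M.region (N.pos u) = g ∧
      (u ∈ D ∨ u ∈ connectors N.sink D par)) ⊆ S ∪ S.image par := by
    intro u hu
    obtain ⟨-, hug, hu⟩ := Finset.mem_filter.1 hu
    have hb := InterferenceModel.mem_region_bounds hM hug
    rcases hu with hu | hu
    · refine Finset.mem_union_left _ (Finset.mem_filter.2 ⟨hu, fun j => ?_⟩)
      have := hb j
      simp only [a]
      constructor <;> linarith
    · obtain ⟨d, hd, hds, rfl⟩ := mem_connectors.1 hu
      refine Finset.mem_union_right _ (Finset.mem_image_of_mem _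
        (Finset.mem_filter.2 ⟨hd, fun j => ?_⟩))
      have h1 := hb j
      have h2 := (InterferenceModel.abs_sub_le_dist (N.pos d) (N.pos (par d)) j).trans
        (h.par_dominator d hd hds).1.2
      rw [abs_le] at h2
      simp only [a]
      constructor <;> linarith
  have hcard := (Finset.card_le_card hsub).trans ((Finset.card_union_le _ _).trans
    (add_le_add_right Finset.card_image_le _))
  have hcard' : ((Finset.univ.filter fun u => M.region (N.pos u) = g ∧
      (u ∈ D ∨ u ∈ connectors N.sink D par)).card : ℝ) ≤ S.card + S.card := by
    exact_mod_cast hcard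
  have := hM.two_mul_sq_add_one_le_c₃
  linarith

/-- Each CDS node may have to relay everything, but there are at most `c₃ - 1` of them in a region;
the remaining nodes are leaves and together carry at most the total load once. -/
theorem IsCDSTree.regionLoad_le (h : IsCDSTree (N.graph M) N.sink D par) (hM : M.Valid)
    (hconn : (N.graph M).Connected) (g : ℤ × ℤ) :
    regionLoad M N Q par g ≤ M.c₃ * ∑ i, ((Q i).sources.card : ℝ) * (Q i).χ / (Q i).p := by
  set W := ∑ i, ((Q i).sources.card : ℝ) * (Q i).χ / (Q i).p
  have hW : 0 ≤ W := (relayLoad_nonneg Q par N.sink).trans (relayLoad_le_total Q par N.sink)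
  rw [regionLoad, ← Finset.sum_filter_add_sum_filter_not _
    (fun u => u ∈ D ∨ u ∈ connectors N.sink D par), Finset.filter_filter, Finset.filter_filter]
  have h1 := Finset.sum_le_card_nsmul (Finset.univ.filter fun u => M.region (N.pos u) = g ∧
      (u ∈ D ∨ u ∈ connectors N.sink D par)) (relayLoad Q par) W
    fun u _ => relayLoad_le_total Q par u
  have h2 := sum_relayLoad_le_of_leaves (Q := Q) (Finset.univ.filter fun u =>
    M.region (N.pos u) = g ∧ ¬ (u ∈ D ∨ u ∈ connectors N.sink D par)) fun u hu =>
      have hu' := not_or.1 (Finset.mem_filter.1 hu).2.2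
      h.subtree_eq_singleton hconn hu'.1 hu'.2
  have h3 := mul_le_mul_of_nonneg_right (h.card_region_add_one_le hM g) hW
  rw [nsmul_eq_mul] at h1
  change _ ≤ W at h2
  linarith

theorem slotStart_eq (u : V) (k : ℕ) :
    slotStart M N Q T par u k = slotStart M N Q T par u 0 + k * (M.c₂ * T) := by
  simp only [slotStart]
  push_cast
  ring

theorem slotStart_mono (hT : 0 ≤ T) (u : V) : Monotone (slotStart M N Q T par u) := by
  intro k l hkl
  rw [slotStart_eq u k, slotStart_eq u l]
  gcongr

/-- The beginning of the active period of the region of `u` in the first cycle. -/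
theorem colorStart_le_slotStart (hT : 0 ≤ T) (u : V) :
    InterferenceModel.regionColor M.colorPeriod (M.region (N.pos u)) * T ≤
      slotStart M N Q T par u 0 := by
  rw [slotStart]
  have := Finset.sum_nonneg (s := Finset.univ.filter fun w =>
    M.region (N.pos w) = M.region (N.pos u) ∧ w < u)
    fun w _ => slotLength_nonneg (M := M) (N := N) (Q := Q) (par := par) hT w
  push_cast
  linarith

theorem slotEnd_le_colorEnd (hT : 0 ≤ T) (u : V) :
    slotStart M N Q T par u 0 + slotLength M N Q T par u ≤
      (InterferenceModel.regionColor M.colorPeriod (M.region (N.pos u)) + 1) * T := by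
  have hnot : u ∉ Finset.univ.filter fun w => M.region (N.pos w) = M.region (N.pos u) ∧ w < u := by
    simp
  have := sum_slotLength_le (M := M) (N := N) (Q := Q) (par := par) hT (M.region (N.pos u))
    (insert u (Finset.univ.filter fun w => M.region (N.pos w) = M.region (N.pos u) ∧ w < u)) (by
      intro w hw
      rcases Finset.mem_insert.1 hw with rfl | hw
      · rfl
      · exact (Finset.mem_filter.1 hw).2.1)
  rw [Finset.sum_insert hnot] at this
  rw [slotStart]
  push_cast
  linarith

theorem slotStart_zero_nonneg (hT : 0 ≤ T) (u : V) : 0 ≤ slotStart M N Q T par u 0 :=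
  (mul_nonneg (Nat.cast_nonneg _) hT).trans (colorStart_le_slotStart hT u)

theorem slotEnd_le_cycle (hM : M.Valid) (hT : 0 ≤ T) (u : V) :
    slotStart M N Q T par u 0 + slotLength M N Q T par u ≤ M.c₂ * T := by
  refine (slotEnd_le_colorEnd hT u).trans (mul_le_mul_of_nonneg_right ?_ hT)
  exact_mod_cast InterferenceModel.regionColor_lt hM.colorPeriod_spec.1 _

theorem slotEnd_le_next (hM : M.Valid) (hT : 0 ≤ T) (u : V) {k l : ℕ} (hkl : k < l) :
    slotStart M N Q T par u k + slotLength M N Q T par u ≤ slotStart M N Q T par u l := by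
  refine le_trans ?_ (slotStart_mono hT u (Nat.succ_le_of_lt hkl))
  rw [slotStart_eq u k, slotStart_eq u (k.succ)]
  have h1 := slotEnd_le_cycle (N := N) (Q := Q) (par := par) hM hT u
  have h2 := slotStart_zero_nonneg (M := M) (N := N) (Q := Q) (par := par) hT u
  push_cast
  linarith

/-- Slots of different nodes of one region do not overlap. -/
theorem slotEnd_le_slotStart_of_lt (hT : 0 ≤ T) {u w : V}
    (hr : M.region (N.pos w) = M.region (N.pos u)) (hlt : w < u) :
    slotStart M N Q T par w 0 + slotLength M N Q T par w ≤ slotStart M N Q T par u 0 := by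
  have hnot : w ∉ Finset.univ.filter fun x => M.region (N.pos x) = M.region (N.pos w) ∧ x < w := by
    simp
  have := Finset.sum_le_sum_of_subset_of_nonneg (f := slotLength M N Q T par)
    (s := insert w (Finset.univ.filter fun x => M.region (N.pos x) = M.region (N.pos w) ∧ x < w))
    (t := Finset.univ.filter fun x => M.region (N.pos x) = M.region (N.pos u) ∧ x < u) (by
      intro x hx
      rw [Finset.mem_filter]
      refine ⟨Finset.mem_univ _, ?_⟩
      rcases Finset.mem_insert.1 hx with rfl | hx
      · exact ⟨hr, hlt⟩
      · obtain ⟨-, h1, h2⟩ := Finset.mem_filter.1 hx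
        exact ⟨h1.trans hr, h2.trans hlt⟩) fun x _ _ => slotLength_nonneg hT x
  rw [Finset.sum_insert hnot] at this
  rw [slotStart, slotStart, hr]
  rw [hr] at this
  linarith

/-- Slots of nodes of different color, or of one region, do not overlap. -/
theorem slots_disjoint (hT : 0 ≤ T) {u w : V} (hne : w ≠ u)
    (h : InterferenceModel.regionColor M.colorPeriod (M.region (N.pos w)) =
      InterferenceModel.regionColor M.colorPeriod (M.region (N.pos u)) →
      M.region (N.pos w) = M.region (N.pos u)) :
    slotStart M N Q T par w 0 + slotLength M N Q T par w ≤ slotStart M N Q T par u 0 ∨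
      slotStart M N Q T par u 0 + slotLength M N Q T par u ≤ slotStart M N Q T par w 0 := by
  have key {x y : V}
      (hc : InterferenceModel.regionColor M.colorPeriod (M.region (N.pos x)) <
        InterferenceModel.regionColor M.colorPeriod (M.region (N.pos y))) :
      slotStart M N Q T par x 0 + slotLength M N Q T par x ≤ slotStart M N Q T par y 0 := by
    refine (slotEnd_le_colorEnd hT x).trans (le_trans ?_ (colorStart_le_slotStart hT y))
    exact mul_le_mul_of_nonneg_right (by exact_mod_cast hc) hT
  rcases lt_trichotomy (InterferenceModel.regionColor M.colorPeriod (M.region (N.pos w)))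
    (InterferenceModel.regionColor M.colorPeriod (M.region (N.pos u))) with hc | hc | hc
  · exact Or.inl (key hc)
  · rcases lt_or_gt_of_ne hne with hlt | hlt
    · exact Or.inl (slotEnd_le_slotStart_of_lt hT (h hc) hlt)
    · exact Or.inr (slotEnd_le_slotStart_of_lt hT (h hc).symm hlt)
  · exact Or.inr (key hc)

/-- A slot is long enough for the load that arrives in the course of a cycle, increased by one
more data unit per source and query. -/
theorem IsCDSTree.work_le_slotLength (h : IsCDSTree (N.graph M) N.sink D par) (hM : M.Valid)
    (hconn : (N.graph M).Connected) (hT : 0 < T)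
    (hload : ∑ i, ((Q i).sources.card : ℝ) * (Q i).χ / (Q i).p ≤ 0.69 / (M.c₂ * M.c₃)) (u : V) :
    T * (M.c₂ + 1) * relayLoad Q par u ≤ slotLength M N Q T par u := by
  rcases (relayLoad_nonneg Q par u).eq_or_lt with h0 | h0
  · rw [← h0, mul_zero]
    exact slotLength_nonneg hT.le u
  have hg := h0.trans_le (relayLoad_le_regionLoad M N Q par u)
  have hc₂ : (4 : ℝ) ≤ M.c₂ := by exact_mod_cast hM.four_le_c₂
  have hc₃ := hM.c₃_pos
  have hle : regionLoad M N Q par (M.region (N.pos u)) * M.c₂ ≤ 0.69 := by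
    have h1 := h.regionLoad_le (Q := Q) hM hconn (M.region (N.pos u))
    have h2 := mul_le_mul_of_nonneg_left hload hc₃.le
    have h3 : M.c₃ * (0.69 / (M.c₂ * M.c₃)) * M.c₂ = 0.69 := by field_simp
    rw [← h3]
    exact mul_le_mul_of_nonneg_right (h1.trans h2) (by linarith)
  rw [slotLength, mul_assoc]
  refine mul_le_mul_of_nonneg_left ?_ hT.le
  rw [le_div_iff₀ hg]
  -- With `L` the load of the region, `c₂ * L ≤ 0.69` and `c₂ ≥ 4` give `L ≤ 0.1725`, hence `(c₂ +
  -- 1) * L ≤ 0.8625`.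
  have h4 : (M.c₂ + 1) * regionLoad M N Q par (M.region (N.pos u)) ≤ 1 := by
    have : 4 * regionLoad M N Q par (M.region (N.pos u)) ≤ 0.69 := by nlinarith
    linarith
  nlinarith

end Slots

/-! ## A single node with periodic slots -/

section Server

/-- The tie-breaking entries, together with the query ID, name the packet. Priorities are therefore
strict, which makes transmissions within a slot consecutive. -/
theorem priority_injective {V ι : Type*} (Q : ι → Query V) (arr : Packet V ι → EReal) (t : ℝ) :
    Function.Injective (priority Q arr t) := by
  rintro ⟨i, v, n⟩ ⟨j, w, m⟩ h
  simp only [priority, EmbeddingLike.apply_eq_iff_eq, Prod.mk.injEq] at h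
  obtain ⟨-, -, h1, -, h2, h3⟩ := h
  subst h1 h2 h3
  rfl

variable {V ι : Type*} [LinearOrder V] [LinearOrder ι] {Q : ι → Query V}
  {arr : Packet V ι → EReal} {len : ℝ} {start : ℕ → ℝ}

theorem workUpTo_nonneg (done : Set (Packet V ι)) (t : ℝ) (q : Packet V ι) :
    0 ≤ workUpTo Q arr done t q :=
  finsum_nonneg fun r => finsum_nonneg fun _ => (Q r.query).χ_pos.le

theorem sentBefore_mono : Monotone (sentBefore Q arr len start) :=
  monotone_nat_of_le_succ fun _ => Set.subset_union_left

theorem mem_sentBefore_iff {q : Packet V ι} {k : ℕ} :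
    q ∈ sentBefore Q arr len start k ↔
      ∃ j < k, q ∈ sentInSlot Q arr len (start j) (sentBefore Q arr len start j) := by
  induction k with
  | zero => simp [sentBefore]
  | succ k ih =>
    rw [sentBefore, Set.mem_union, ih]
    constructor
    · rintro (⟨j, hj, h⟩ | h)
      · exact ⟨j, hj.trans (Nat.lt_succ_self k), h⟩
      · exact ⟨k, Nat.lt_succ_self k, h⟩
    · rintro ⟨j, hj, h⟩
      rcases Nat.lt_succ_iff_lt_or_eq.1 hj with hj | rfl
      · exact Or.inl ⟨j, hj, h⟩
      · exact Or.inr h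

theorem SendsAt.index_eq {q : Packet V ι} {k k' : ℕ} {τ τ' : ℝ}
    (h : SendsAt Q arr len start q k τ) (h' : SendsAt Q arr len start q k' τ') : k = k' := by
  by_contra hne
  rcases lt_or_gt_of_ne hne with hlt | hlt
  · exact h'.1.1.2 (mem_sentBefore_iff.2 ⟨k, hlt, h.1⟩)
  · exact h.1.1.2 (mem_sentBefore_iff.2 ⟨k', hlt, h'.1⟩)

theorem SendsAt.time_eq {q : Packet V ι} {k k' : ℕ} {τ τ' : ℝ}
    (h : SendsAt Q arr len start q k τ) (h' : SendsAt Q arr len start q k' τ') : τ = τ' := by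
  rw [h.2, h'.2, h.index_eq h']

theorem SendsAt.arr_le {q : Packet V ι} {k : ℕ} {τ : ℝ} (h : SendsAt Q arr len start q k τ) :
    arr q ≤ (start k : EReal) := h.1.1.1

theorem SendsAt.start_le {q : Packet V ι} {k : ℕ} {τ : ℝ} (h : SendsAt Q arr len start q k τ) :
    start k ≤ τ := by
  rw [h.2]
  exact le_add_of_nonneg_right (workUpTo_nonneg _ _ _)

theorem SendsAt.le_end {q : Packet V ι} {k : ℕ} {τ : ℝ} (h : SendsAt Q arr len start q k τ) :
    τ ≤ start k + len := by
  rw [h.2]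
  exact add_le_add_right h.1.2 _

theorem SendsAt.finishTime_eq {q : Packet V ι} {k : ℕ} {τ : ℝ}
    (h : SendsAt Q arr len start q k τ) : finishTime Q arr len start q = (τ : EReal) := by
  apply le_antisymm
  · exact iInf_le_of_le k (iInf₂_le_of_le τ h le_rfl)
  · exact le_iInf fun k' => le_iInf₂ fun τ' h' => by rw [h.time_eq h']

theorem exists_sendsAt_of_finishTime_lt_top {q : Packet V ι}
    (h : finishTime Q arr len start q < ⊤) : ∃ k τ, SendsAt Q arr len start q k τ := by
  by_contra! hn
  refine h.ne ?_
  simp [finishTime, hn]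

theorem exists_sendsAt_of_finishTime_le {q : Packet V ι} {t : ℝ}
    (h : finishTime Q arr len start q ≤ (t : EReal)) :
    ∃ k τ, SendsAt Q arr len start q k τ ∧ τ ≤ t := by
  obtain ⟨k, τ, hs⟩ := exists_sendsAt_of_finishTime_lt_top (h.trans_lt (EReal.coe_lt_top t))
  rw [hs.finishTime_eq, EReal.coe_le_coe_iff] at h
  exact ⟨k, τ, hs, h⟩

section Finite

variable (hfin : ∀ t : ℝ, {q | arr q ≤ (t : EReal)}.Finite)

include hfin

/-- A `finsum` over an infinite support defaults to `0`; only for a finite buffer is `workUpTo` the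
actual amount of work. -/
theorem workUpTo_eq_sum (done : Set (Packet V ι)) (t : ℝ) (q : Packet V ι) :
    ∃ B : Finset (Packet V ι), workUpTo Q arr done t q = ∑ r ∈ B, r.χ Q ∧
      ∀ r, r ∈ B ↔ r ∈ buffer arr done t ∧ priority Q arr t r ≤ priority Q arr t q := by
  have hf : {r | r ∈ buffer arr done t ∧ priority Q arr t r ≤ priority Q arr t q}.Finite :=
    (hfin t).subset fun r hr => hr.1.1
  exact ⟨hf.toFinset, finsum_mem_eq_finite_toFinset_sum _ hf, fun r => hf.mem_toFinset⟩

/-- Packets sent in one slot are sent one after the other. -/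
theorem workUpTo_add_le {done : Set (Packet V ι)} {t : ℝ} {q r : Packet V ι}
    (hr : r ∈ buffer arr done t) (hlt : priority Q arr t q < priority Q arr t r) :
    workUpTo Q arr done t q + r.χ Q ≤ workUpTo Q arr done t r := by
  obtain ⟨B, hB, hBm⟩ := workUpTo_eq_sum (Q := Q) hfin done t q
  obtain ⟨B', hB', hBm'⟩ := workUpTo_eq_sum (Q := Q) hfin done t r
  have hrB : r ∉ B := fun h => not_le.2 hlt ((hBm r).1 h).2
  rw [hB, hB', add_comm, ← Finset.sum_insert hrB]
  refine Finset.sum_le_sum_of_subset_of_nonneg ?_ fun x _ _ => (Q x.query).χ_pos.le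
  intro x hx
  rw [hBm']
  rcases Finset.mem_insert.1 hx with rfl | hx
  · exact ⟨hr, le_rfl⟩
  · exact ⟨((hBm x).1 hx).1, ((hBm x).1 hx).2.trans hlt.le⟩

theorem SendsAt.start_add_le {q : Packet V ι} {k : ℕ} {τ : ℝ}
    (h : SendsAt Q arr len start q k τ) : start k + q.χ Q ≤ τ := by
  obtain ⟨B, hB, hBm⟩ := workUpTo_eq_sum (Q := Q) hfin
    (sentBefore Q arr len start k) (start k) q
  rw [h.2, hB]
  refine add_le_add_right ?_ _
  exact Finset.single_le_sum (f := fun r : Packet V ι => r.χ Q)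
    (fun x _ => (Q x.query).χ_pos.le) ((hBm q).2 ⟨h.1.1, le_rfl⟩)

/-- A node sends its packets one at a time. -/
theorem SendsAt.disjoint (hlen : ∀ k l, k < l → start k + len ≤ start l) {q r : Packet V ι}
    (hne : q ≠ r) {k l : ℕ} {τ σ : ℝ} (hq : SendsAt Q arr len start q k τ)
    (hr : SendsAt Q arr len start r l σ) : τ ≤ σ - r.χ Q ∨ σ ≤ τ - q.χ Q := by
  rcases lt_trichotomy k l with hlt | rfl | hlt
  · left
    linarith [hq.le_end, hlen k l hlt, hr.start_add_le hfin]
  · rcases lt_or_gt_of_ne ((priority_injective Q arr (start k)).ne hne) with hlt | hlt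
    · left
      have := workUpTo_add_le hfin hr.1.1 hlt
      rw [hq.2, hr.2]
      linarith
    · right
      have := workUpTo_add_le hfin hq.1.1 hlt
      rw [hq.2, hr.2]
      linarith
  · right
    linarith [hr.le_end, hlen l k hlt, hq.start_add_le hfin]

section Work

variable (hwork : ∀ (k : ℕ) (B : Finset (Packet V ι)),
  (∀ q ∈ B, arr q ≤ (start k : EReal) ∧ ∀ j < k, (start j : EReal) < arr q) →
    ∑ q ∈ B, q.χ Q ≤ len)

include hwork

/-- If the packets that arrive between two slots always fit into a slot, then each slot empties
the buffer. -/
theorem mem_sentBefore_succ {q : Packet V ι} {k : ℕ} (hq : arr q ≤ (start k : EReal)) :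
    q ∈ sentBefore Q arr len start (k + 1) := by
  induction k using Nat.strong_induction_on generalizing q with
  | _ k ih =>
    by_cases hd : q ∈ sentBefore Q arr len start k
    · exact Or.inl hd
    · refine Or.inr ⟨⟨hq, hd⟩, ?_⟩
      obtain ⟨B, hB, hBm⟩ := workUpTo_eq_sum (Q := Q) hfin
        (sentBefore Q arr len start k) (start k) q
      rw [hB]
      refine hwork k B fun r hr => ?_
      obtain ⟨⟨hr1, hr2⟩, -⟩ := (hBm r).1 hr
      refine ⟨hr1, fun j hj => ?_⟩
      by_contra! hle
      -- A packet that had arrived by an earlier slot was sent by the end of that slot, so the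
      -- buffer holds new arrivals only.
      exact hr2 (sentBefore_mono hj (ih j hj hle))

theorem exists_sendsAt {q : Packet V ι} {k : ℕ} (hq : arr q ≤ (start k : EReal)) :
    ∃ j ≤ k, ∃ τ, SendsAt Q arr len start q j τ := by
  obtain ⟨j, hj, hs⟩ := mem_sentBefore_iff.1 (mem_sentBefore_succ hfin hwork hq)
  exact ⟨j, Nat.lt_succ_iff.1 hj, _, hs, rfl⟩

/-- Transfers arrival times from a child to its parent: for a parent's slot beginning at `t`,
between two slots of the child, all that counts is what the child had at its last slot. -/
theorem finishTime_le_iff (hstart : Monotone start) {q : Packet V ι} {k : ℕ} {t : ℝ}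
    (h1 : start k + len ≤ t) (h2 : t ≤ start (k + 1)) :
    finishTime Q arr len start q ≤ (t : EReal) ↔ arr q ≤ (start k : EReal) := by
  constructor
  · intro h
    obtain ⟨j, τ, hs, hτ⟩ := exists_sendsAt_of_finishTime_le h
    have h3 := hs.start_add_le hfin
    have h4 : 0 < q.χ Q := (Q q.query).χ_pos
    have hj : j < k + 1 := hstart.reflect_lt (by linarith)
    exact hs.arr_le.trans (EReal.coe_le_coe (hstart (Nat.lt_succ_iff.1 hj)))
  · intro h
    obtain ⟨j, hj, τ, hs⟩ := exists_sendsAt hfin hwork h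
    rw [hs.finishTime_eq, EReal.coe_le_coe_iff]
    linarith [hs.le_end, hstart hj]

end Work

theorem lt_finishTime (hstart : Monotone start) {q : Packet V ι} {t : ℝ} (h : t ≤ start 0) :
    (t : EReal) < finishTime Q arr len start q := by
  by_contra! hle
  obtain ⟨j, τ, hs, hτ⟩ := exists_sendsAt_of_finishTime_le hle
  have h3 := hs.start_add_le hfin
  have h4 : 0 < q.χ Q := (Q q.query).χ_pos
  linarith [hstart (Nat.zero_le j)]

end Finite

end Server

/-! ## Counting the data units that are released in a cycle -/

theorem card_le_of_mul_sub_le {F : Finset ℕ} {p c : ℝ} (hp : 0 < p) (hc : 0 ≤ c)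
    (h : ∀ n ∈ F, ∀ m ∈ F, (n - m : ℝ) * p ≤ c) : (F.card : ℝ) ≤ c / p + 1 := by
  rcases F.eq_empty_or_nonempty with rfl | hF
  · rw [Finset.card_empty, Nat.cast_zero]
    positivity
  · have h1 := h _ (F.max'_mem hF) _ (F.min'_mem hF)
    rw [← le_div_iff₀ hp] at h1
    have hle : F.min' hF ≤ F.max' hF := F.min'_le _ (F.max'_mem hF)
    have h2 : F.card ≤ F.max' hF - F.min' hF + 1 := by
      have := Finset.card_le_card (show F ⊆ Finset.Icc (F.min' hF) (F.max' hF) from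
        fun n hn => Finset.mem_Icc.2 ⟨F.min'_le n hn, F.le_max' n hn⟩)
      rw [Nat.card_Icc] at this
      omega
    have h3 : (F.card : ℝ) ≤ ((F.max' hF - F.min' hF : ℕ) : ℝ) + 1 := by exact_mod_cast h2
    rw [Nat.cast_sub hle] at h3
    linarith

section Work

variable {V ι : Type*} [Fintype V] [Fintype ι] {Q : ι → Query V} {par : V → V} {T : ℝ}

/-- The work due to data units of which those of one source and query are released in a window
of length `c`. -/
theorem sum_χ_le {u : V} {c : ℝ} (hc : 0 ≤ c) (hT : ∀ i, (Q i).p < T) (B : Finset (Packet V ι))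
    (hdata : ∀ q ∈ B, q.IsData Q ∧ q.source ∈ subtree par u)
    (hwin : ∀ q ∈ B, ∀ r ∈ B, q.query = r.query → q.source = r.source →
      q.release Q - r.release Q ≤ c) :
    ∑ q ∈ B, q.χ Q ≤ (c + T) * relayLoad Q par u := by
  let f (q : Packet V ι) : (_ : ι) × V := ⟨q.query, q.source⟩
  have hmaps : ∀ q ∈ B, f q ∈ Finset.univ.sigma fun i => (Q i).sources ∩ subtree par u :=
    fun q hq => Finset.mem_sigma.2 ⟨Finset.mem_univ _, Finset.mem_inter.2 (hdata q hq)⟩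
  have hfiber (y : (_ : ι) × V) : ∑ q ∈ B with f q = y, q.χ Q ≤
      (c + T) * ((Q y.1).χ / (Q y.1).p) := by
    have hχ := (Q y.1).χ_pos
    have hp := (Q y.1).p_pos
    have e : ∑ q ∈ B with f q = y, q.χ Q = (B.filter fun q => f q = y).card * (Q y.1).χ := by
      rw [← nsmul_eq_mul, ← Finset.sum_const]
      refine Finset.sum_congr rfl fun q hq => ?_
      rw [← (Finset.mem_filter.1 hq).2]
      rfl
    have hinj : Set.InjOn (Packet.inst : Packet V ι → ℕ) ↑(B.filter fun q => f q = y) := by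
      rintro ⟨i, v, n⟩ hq ⟨j, w, m⟩ hr rfl
      have e := (Finset.mem_filter.1 hq).2.trans (Finset.mem_filter.1 hr).2.symm
      simp only [f, Sigma.mk.injEq, heq_eq_eq] at e
      obtain ⟨rfl, rfl⟩ := e
      rfl
    have hcard : ((B.filter fun q => f q = y).card : ℝ) ≤ c / (Q y.1).p + 1 := by
      rw [← Finset.card_image_of_injOn hinj]
      refine card_le_of_mul_sub_le hp hc fun n hn m hm => ?_
      obtain ⟨q, hq, rfl⟩ := Finset.mem_image.1 hn
      obtain ⟨r, hr, rfl⟩ := Finset.mem_image.1 hm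
      obtain ⟨hqB, rfl⟩ := Finset.mem_filter.1 hq
      obtain ⟨hrB, he⟩ := Finset.mem_filter.1 hr
      simp only [f, Sigma.mk.injEq, heq_eq_eq] at he
      have := hwin q hqB r hrB he.1.symm he.2.symm
      rw [Packet.release, Packet.release, he.1] at this
      change _ * (Q q.query).p ≤ c
      linarith
    rw [e]
    calc ((B.filter fun q => f q = y).card : ℝ) * (Q y.1).χ
        ≤ (c / (Q y.1).p + T / (Q y.1).p) * (Q y.1).χ := by
          refine mul_le_mul_of_nonneg_right (hcard.trans ?_) hχ.le
          -- The assumption `p < T` pays for the extra instance: `1 ≤ T / p`.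
          have := (one_le_div hp).2 (hT y.1).le
          linarith
      _ = (c + T) * ((Q y.1).χ / (Q y.1).p) := by ring
  rw [← Finset.sum_fiberwise_of_maps_to hmaps]
  refine (Finset.sum_le_sum fun y _ => hfiber y).trans (le_of_eq ?_)
  rw [← Finset.mul_sum, Finset.sum_sigma, relayLoad_eq_sum]
  congr 1
  refine Finset.sum_congr rfl fun i _ => ?_
  dsimp only
  rw [Finset.sum_const, nsmul_eq_mul, mul_div_assoc]

theorem finite_setOf_release_le (Q : ι → Query V) (t : ℝ) :
    {q : Packet V ι | q.release Q ≤ t}.Finite := by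
  let f (q : Packet V ι) : ι × V × ℕ := (q.query, q.source, q.inst)
  have hf : Function.Injective f := by
    rintro ⟨i, v, n⟩ ⟨j, w, m⟩ h
    simp only [f, Prod.mk.injEq] at h
    obtain ⟨rfl, rfl, rfl⟩ := h
    rfl
  let b := Finset.univ.sup fun i => ⌊t / (Q i).p⌋₊
  refine ((Set.finite_univ.prod (Set.finite_univ.prod (Set.finite_Iic b))).preimage
    (hf.injOn (s := _))).subset fun q hq => ⟨trivial, trivial, ?_⟩
  refine le_trans ?_ (Finset.le_sup (f := fun i => ⌊t / (Q i).p⌋₊) (Finset.mem_univ q.query))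
  refine Nat.le_floor ((le_div_iff₀ (Q q.query).p_pos).2 ?_)
  have h1 : q.release Q ≤ t := hq
  have h2 := (Q q.query).a_nonneg
  rw [Packet.release] at h1
  linarith

end Work

/-! ## Arrival of packets in the routing tree -/

section Arrival

variable {V ι : Type*} [LinearOrder V] [LinearOrder ι] [Fintype V] [Fintype ι]
  {M : InterferenceModel} {N : Network V} {Q : ι → Query V} {T : ℝ} {par : V → V}

theorem arrival_source {q : Packet V ι} (hq : q.IsData Q) :
    arrival M N Q T par q.source q = (q.release Q : EReal) := by
  rw [arrival, if_pos ⟨rfl, hq⟩]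

theorem arrival_of_not {u : V} {q : Packet V ι} (hq : ¬ (q.source = u ∧ q.IsData Q)) :
    arrival M N Q T par u q = ⨅ (c : V) (_ : IsChild N.sink par c u),
      finishTime Q (arrival M N Q T par c) (slotLength M N Q T par c)
        (slotStart M N Q T par c) q := by
  rw [arrival, if_neg hq]

theorem exists_child_sendsAt {u : V} {q : Packet V ι} {t : ℝ}
    (hq : ¬ (q.source = u ∧ q.IsData Q)) (h : arrival M N Q T par u q ≤ (t : EReal)) :
    ∃ c, IsChild N.sink par c u ∧ ∃ k τ, SendsAt Q (arrival M N Q T par c)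
      (slotLength M N Q T par c) (slotStart M N Q T par c) q k τ ∧ τ ≤ t := by
  rw [arrival_of_not hq] at h
  have : Nonempty V := ⟨u⟩
  -- There are finitely many nodes, so the infimum is attained.
  obtain ⟨c, hc⟩ := exists_eq_ciInf_of_finite (f := fun c : V =>
    ⨅ (_ : IsChild N.sink par c u), finishTime Q (arrival M N Q T par c)
      (slotLength M N Q T par c) (slotStart M N Q T par c) q)
  rw [← hc] at h
  by_cases hcu : IsChild N.sink par c u
  · rw [iInf_pos hcu] at h
    exact ⟨c, hcu, exists_sendsAt_of_finishTime_le h⟩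
  · rw [iInf_neg hcu] at h
    exact absurd h (not_le.2 (EReal.coe_lt_top t))

/-- Only data units arrive at a node, from sources in its subtree and after their release. -/
theorem data_of_arrival_le (u : V) : ∀ {q : Packet V ι} {t : ℝ},
    arrival M N Q T par u q ≤ (t : EReal) →
      q.IsData Q ∧ q.source ∈ subtree par u ∧ q.release Q ≤ t := by
  induction u using child_induction (par := par) (s := N.sink) with
  | step u ih =>
    intro q t h
    by_cases hq : q.source = u ∧ q.IsData Q
    · obtain ⟨rfl, hd⟩ := hq
      rw [arrival_source hd, EReal.coe_le_coe_iff] at h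
      exact ⟨hd, mem_subtree_self _, h⟩
    · obtain ⟨c, hc, k, τ, hs, hτ⟩ := exists_child_sendsAt hq h
      obtain ⟨h1, h2, h3⟩ := ih c hc hs.arr_le
      exact ⟨h1, hc.subtree_subset h2, h3.trans (hs.start_le.trans hτ)⟩

theorem finite_arrival_le (u : V) (t : ℝ) :
    {q | arrival M N Q T par u q ≤ (t : EReal)}.Finite :=
  (finite_setOf_release_le Q t).subset fun _ hq => (data_of_arrival_le u hq).2.2

/-- Only one child has the source in its subtree; no other child ever sends the packet, so its entry
in the infimum is `⊤`. -/
theorem arrival_eq_finishTime (hs : par N.sink = N.sink) (hreach : ∀ u, ∃ n, par^[n] u = N.sink)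
    {u c : V} (hc : IsChild N.sink par c u) {q : Packet V ι} (hq : q.source ∈ subtree par c) :
    arrival M N Q T par u q = finishTime Q (arrival M N Q T par c) (slotLength M N Q T par c)
      (slotStart M N Q T par c) q := by
  rw [arrival_of_not]
  · refine le_antisymm (iInf₂_le c hc) (le_iInf₂ fun c' hc' => ?_)
    by_contra! hlt
    obtain ⟨k, τ, hsend⟩ := exists_sendsAt_of_finishTime_lt_top (hlt.trans_le le_top)
    have := child_unique hs hreach hc hc' hq (data_of_arrival_le c' hsend.arr_le).2.1
    subst this
    exact lt_irrefl _ hlt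
  · rintro ⟨rfl, -⟩
    have := depth_le_of_mem_subtree hreach hs hq
    have := hc.2
    omega

/-- The data units of one source and query arrive at `u` in step with the slots of `u`: up to the
`k`-th slot arrive those which are released up to the `k`-th one of some periodic sequence of
times. The delay is at most one cycle per hop. -/
def ArrivesInStep (M : InterferenceModel) (N : Network V) (Q : ι → Query V) (T : ℝ)
    (par : V → V) (u : V) : Prop :=
  ∀ i, ∀ v ∈ (Q i).sources, v ∈ subtree par u → ∃ θ < M.c₂ * T,
    slotStart M N Q T par u 0 - θ ≤
      ((depth N.sink par v : ℝ) - depth N.sink par u) * (M.c₂ * T) ∧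
    ∀ n k, arrival M N Q T par u ⟨i, v, n⟩ ≤ (slotStart M N Q T par u k : EReal) ↔
      Packet.release Q (⟨i, v, n⟩ : Packet V ι) ≤ θ + k * (M.c₂ * T)

/-- New arrivals at slot `k` from one source and query are released in a window of one cycle ending
at `θ + k * (c₂ * T)`. Their work fits into the slot, which is the hypothesis `hwork` on a single
node. -/
theorem ArrivesInStep.sum_χ_le {u : V} (h : ArrivesInStep M N Q T par u) (hT0 : 0 < T)
    (hT : ∀ i, (Q i).p < T)
    (hslot : T * (M.c₂ + 1) * relayLoad Q par u ≤ slotLength M N Q T par u)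
    (k : ℕ) (B : Finset (Packet V ι))
    (hB : ∀ q ∈ B, arrival M N Q T par u q ≤ (slotStart M N Q T par u k : EReal) ∧
      ∀ j < k, (slotStart M N Q T par u j : EReal) < arrival M N Q T par u q) :
    ∑ q ∈ B, q.χ Q ≤ slotLength M N Q T par u := by
  have hC : 0 ≤ M.c₂ * T := by positivity
  have hdata (q : Packet V ι) (hq : q ∈ B) := data_of_arrival_le u (hB q hq).1
  refine (WSN.sum_χ_le hC hT B (fun q hq => ⟨(hdata q hq).1, (hdata q hq).2.1⟩) ?_).trans
    (le_trans (le_of_eq (by ring)) hslot)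
  rintro ⟨i, v, n⟩ hq ⟨j, w, m⟩ hr he1 he2
  dsimp only at he1 he2
  subst he1 he2
  obtain ⟨hd, hsub, -⟩ := hdata _ hq
  obtain ⟨θ, hθ, -, hiff⟩ := h i v hd hsub
  have h1 := (hiff n k).1 (hB _ hq).1
  suffices h2 : θ + k * (M.c₂ * T) - M.c₂ * T ≤
      Packet.release Q (⟨i, v, m⟩ : Packet V ι) by linarith
  cases k with
  -- Before the first slot the window starts at `θ - c₂ * T < 0`, earlier than any release; hence
  -- the requirement `θ < c₂ * T`.
  | zero =>
    have h3 : 0 ≤ Packet.release Q (⟨i, v, m⟩ : Packet V ι) :=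
      add_nonneg (Q i).a_nonneg (mul_nonneg (Nat.cast_nonneg _) (Q i).p_pos.le)
    push_cast
    linarith
  | succ k =>
    have h3 := mt (hiff m k).2 (not_le.2 ((hB _ hr).2 k (Nat.lt_succ_self k)))
    push_cast
    linarith

end Arrival

/-! ### Timeliness and validity of the schedule -/

section Main

variable {V ι : Type*} [LinearOrder V] [LinearOrder ι] [Fintype V] [Fintype ι]
  {M : InterferenceModel} {N : Network V} {Q : ι → Query V} {T : ℝ} {D : Finset V} {par : V → V}

theorem IsCDSTree.arrivesInStep (h : IsCDSTree (N.graph M) N.sink D par) (hM : M.Valid)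
    (hconn : (N.graph M).Connected) (hT0 : 0 < T) (hT : ∀ i, (Q i).p < T)
    (hload : ∑ i, ((Q i).sources.card : ℝ) * (Q i).χ / (Q i).p ≤ 0.69 / (M.c₂ * M.c₃)) (u : V) :
    ArrivesInStep M N Q T par u := by
  have hreach := h.reaches_sink hconn
  have hC : 0 ≤ M.c₂ * T := by positivity
  induction u using child_induction (par := par) (s := N.sink) with
  | step u ih =>
    intro i v hv hvu
    by_cases hne : v = u
    · subst hne
      -- The source's own slots serve as release thresholds. The strict bound on `θ` holds because a
      -- source has positive load and so a slot of positive length.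
      refine ⟨slotStart M N Q T par v 0, ?_, by simp, fun n k => ?_⟩
      · have h1 := slotEnd_le_cycle (N := N) (Q := Q) (par := par) hM hT0.le v
        have h2 := slotLength_pos (M := M) (N := N) hT0 (relayLoad_pos (par := par) hv hvu)
        linarith
      · have e := arrival_source (M := M) (N := N) (T := T) (par := par)
          (show Packet.IsData Q (⟨i, v, n⟩ : Packet V ι) from hv)
        dsimp only at e
        rw [e, EReal.coe_le_coe_iff, ← slotStart_eq]
    · obtain ⟨c, hc, hvc⟩ := exists_child_of_mem_subtree h.par_sink hreach hvu hne
      have harr (n : ℕ) := arrival_eq_finishTime (M := M) (T := T) (Q := Q) h.par_sink hreach hc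
        (q := ⟨i, v, n⟩) hvc
      have hwork := (ih c hc).sum_χ_le hT0 hT (h.work_le_slotLength hM hconn hT0 hload c)
      have hfin := finite_arrival_le (M := M) (N := N) (Q := Q) (T := T) (par := par) c
      have hmono := slotStart_mono (M := M) (N := N) (Q := Q) (par := par) hT0.le c
      obtain ⟨θ, hθ, hdelay, hiff⟩ := ih c hc i v hv hvc
      have hd : (depth N.sink par c : ℝ) = depth N.sink par u + 1 := by exact_mod_cast hc.2
      have hcu := h.adj_par hc.ne_root
      rw [hc.1] at hcu
      have hu0 := slotStart_zero_nonneg (M := M) (N := N) (Q := Q) (par := par) hT0.le u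
      have hc0 := slotStart_zero_nonneg (M := M) (N := N) (Q := Q) (par := par) hT0.le c
      have hue := slotEnd_le_cycle (N := N) (Q := Q) (par := par) hM hT0.le u
      have hce := slotEnd_le_cycle (N := N) (Q := Q) (par := par) hM hT0.le c
      have hul := slotLength_nonneg (M := M) (N := N) (Q := Q) (par := par) hT0.le u
      have hcl := slotLength_nonneg (M := M) (N := N) (Q := Q) (par := par) hT0.le c
      rw [hd] at hdelay
      rcases slots_disjoint (Q := Q) (par := par) hT0.le hcu.1 (region_eq_of_adj hM hcu)
        with hcase | hcase
      -- The child's slot precedes that of `u` in each cycle: what it sends in cycle `k` is there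
      -- for slot `k` of `u`.
      · refine ⟨θ, hθ, by linarith, fun n k => ?_⟩
        rw [harr, ← hiff n k]
        refine finishTime_le_iff hfin hwork hmono ?_ ?_ <;>
          rw [slotStart_eq c, slotStart_eq u] <;> push_cast <;> linarith
      · refine ⟨θ - M.c₂ * T, by linarith, by linarith, fun n k => ?_⟩
        rw [harr]
        cases k with
        | zero =>
          have h1 := lt_finishTime (Q := Q) (len := slotLength M N Q T par c) hfin hmono
            (q := ⟨i, v, n⟩) (t := slotStart M N Q T par u 0) (by linarith)
          have h3 : 0 ≤ Packet.release Q (⟨i, v, n⟩ : Packet V ι) :=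
            add_nonneg (Q i).a_nonneg (mul_nonneg (Nat.cast_nonneg _) (Q i).p_pos.le)
          refine iff_of_false (not_le.2 h1) ?_
          push_cast
          linarith
        | succ k =>
          have e : θ - M.c₂ * T + ((k + 1 : ℕ) : ℝ) * (M.c₂ * T) = θ + k * (M.c₂ * T) := by
            push_cast
            ring
          rw [e, ← hiff n k]
          refine finishTime_le_iff hfin hwork hmono ?_ ?_ <;>
            rw [slotStart_eq c, slotStart_eq u] <;> push_cast <;> linarith

theorem IsCDSTree.meetsDeadlines (h : IsCDSTree (N.graph M) N.sink D par) (hM : M.Valid)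
    (hconn : (N.graph M).Connected) (hT0 : 0 < T) (hT : ∀ i, (Q i).p < T)
    (hload : ∑ i, ((Q i).sources.card : ℝ) * (Q i).χ / (Q i).p ≤ 0.69 / (M.c₂ * M.c₃))
    (hdelay : ∀ i, 2 * M.c₂ * T * N.radius M ≤ (Q i).d) :
    MeetsDeadlines N Q (algorithmSchedule M N Q T par) := by
  have hreach := h.reaches_sink hconn
  have hc₂ : (4 : ℝ) ≤ M.c₂ := by exact_mod_cast hM.four_le_c₂
  have hC : 0 < M.c₂ * T := by positivity
  rintro ⟨i, v, n⟩ hq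
  have hdi := hdelay i
  by_cases hv : v = N.sink
  · refine Or.inl ⟨hv, le_add_of_nonneg_right (le_trans ?_ hdi)⟩
    positivity
  · right
    obtain ⟨m, hm⟩ := hreach v
    obtain ⟨u, hu, hvu⟩ := exists_child_of_mem_subtree h.par_sink hreach
      (mem_subtree.2 ⟨m, hm⟩) hv
    have hstep := h.arrivesInStep hM hconn hT0 hT hload u
    have hwork := hstep.sum_χ_le hT0 hT (h.work_le_slotLength hM hconn hT0 hload u)
    have hfin := finite_arrival_le (M := M) (N := N) (Q := Q) (T := T) (par := par) u
    obtain ⟨θ, hθ, hlag, hiff⟩ := hstep i v hq hvu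
    set rel := Packet.release Q (⟨i, v, n⟩ : Packet V ι) with hrel
    -- The first slot of `u`, the last node before the sink, by which the packet has arrived. If the
    -- ceiling is cut off at `0`, then `hk2` rests on `θ < c₂ * T` and `0 ≤ rel`.
    let k := ⌈(rel - θ) / (M.c₂ * T)⌉₊
    have hk1 : rel ≤ θ + k * (M.c₂ * T) := by
      have := (div_le_iff₀ hC).1 (Nat.le_ceil ((rel - θ) / (M.c₂ * T)))
      linarith
    have hk2 : θ + k * (M.c₂ * T) ≤ rel + M.c₂ * T := by
      have h3 : 0 ≤ rel :=
        add_nonneg (Q i).a_nonneg (mul_nonneg (Nat.cast_nonneg _) (Q i).p_pos.le)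
      have h4 : (k : ℝ) ≤ (rel - θ) / (M.c₂ * T) + 1 := by
        rcases le_or_gt 0 ((rel - θ) / (M.c₂ * T)) with h5 | h5
        · exact (Nat.ceil_lt_add_one h5).le
        · have h6 : k = 0 := Nat.ceil_eq_zero.2 h5.le
          rw [h6, Nat.cast_zero, ← sub_le_iff_le_add, zero_sub, le_div_iff₀ hC]
          linarith
      have h5 := mul_le_mul_of_nonneg_right h4 hC.le
      rw [add_mul, div_mul_cancel₀ _ hC.ne'] at h5
      linarith
    obtain ⟨j, hj, τ, hs⟩ := exists_sendsAt hfin hwork ((hiff n k).2 hk1)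
    refine ⟨⟨⟨i, v, n⟩, u, par u, τ - (Q i).χ⟩,
      ⟨hu.ne_root, rfl, j, by simpa [Transmission.finish, Packet.χ] using hs⟩, rfl, hu.1, ?_⟩
    have e : Transmission.finish Q (⟨⟨i, v, n⟩, u, par u, τ - (Q i).χ⟩ : Transmission V ι) = τ := by
      simp [Transmission.finish, Packet.χ]
    rw [e]
    -- The budget in cycles: one to round the release up to a threshold, `depth v - 1` for the lag
    -- at `u`, and one that covers the final slot, in all `depth v + 1 ≤ 2 * R`.
    have h6 : τ ≤ slotStart M N Q T par u k + T :=
      hs.le_end.trans (add_le_add (slotStart_mono hT0.le u hj) (slotLength_le hT0.le u))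
    rw [slotStart_eq] at h6
    have hdu : (depth N.sink par u : ℝ) = 1 := by
      have := hu.2
      rw [depth_root] at this
      exact_mod_cast this
    have hdv : (depth N.sink par v : ℝ) + 1 ≤ 2 * N.radius M := by
      exact_mod_cast h.depth_add_one_le hconn hv
    have h7 := mul_le_mul_of_nonneg_right hdv hC.le
    rw [hdu] at hlag
    have h8 : T ≤ M.c₂ * T := by nlinarith
    change τ ≤ rel + (Q i).d
    linarith

theorem IsCDSTree.isSchedule (h : IsCDSTree (N.graph M) N.sink D par) (hM : M.Valid)
    (hT0 : 0 < T) : IsSchedule M N Q (algorithmSchedule M N Q T par) := by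
  have hfin (u : V) := finite_arrival_le (M := M) (N := N) (Q := Q) (T := T) (par := par) u
  refine ⟨?_, ?_, ?_⟩
  · rintro ⟨q, u, w, t⟩ ⟨hu, hw, k, hs⟩
    have hstart : slotStart M N Q T par u k ≤ t := by
      have := hs.start_add_le (hfin u)
      simp only [Transmission.finish] at this
      linarith
    have harr := hs.arr_le.trans (EReal.coe_le_coe hstart)
    dsimp only at harr hu ⊢
    obtain ⟨h1, -, h3⟩ := data_of_arrival_le u harr
    refine ⟨h1, ?_⟩
    by_cases hq : q.source = u ∧ q.IsData Q
    · exact Or.inl ⟨hq.1.symm, h3⟩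
    · right
      obtain ⟨c, hc, l, τ, hsend, hτ⟩ := exists_child_sendsAt hq harr
      have e : Transmission.finish Q (⟨q, c, par c, τ - q.χ Q⟩ : Transmission V ι) = τ := by
        simp [Transmission.finish]
      exact ⟨⟨q, c, par c, τ - q.χ Q⟩, ⟨hc.ne_root, rfl, l, by rw [e]; exact hsend⟩, rfl, hc.1,
        by rw [e]; exact hτ⟩
  · rintro ⟨q, u, w, t⟩ ⟨hu, hw, k, hs⟩ ⟨q', u', w', t'⟩ ⟨hu', hw', k', hs'⟩ hne he
    dsimp only at he hw hw' hs hs'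
    subst he hw hw'
    have hqq : q ≠ q' := by
      rintro rfl
      have := hs.time_eq hs'
      simp only [Transmission.finish, add_left_inj] at this
      exact hne (by rw [this])
    have := hs.disjoint (hfin u) (fun k l hkl => slotEnd_le_next hM hT0.le u hkl) hqq hs'
    simpa [Transmission.finish] using this
  · intro t
    have hmem {e : Plane × Plane} (he : e ∈ activeLinks N Q (algorithmSchedule M N Q T par) t) :
        ∃ u k, u ≠ N.sink ∧ e = (N.pos u, N.pos (par u)) ∧ slotStart M N Q T par u k ≤ t ∧
          t < slotStart M N Q T par u k + slotLength M N Q T par u := by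
      obtain ⟨⟨a, b⟩, hab, rfl⟩ := Finset.mem_image.1 he
      obtain ⟨-, ⟨q, u, w, t'⟩, ⟨hu, hw, k, hs⟩, h1, h2, h3, h4⟩ := Finset.mem_filter.1 hab
      dsimp only at hu hw h1 h2 h3 hs
      subst h1 h2 hw
      have h5 := hs.start_add_le (hfin u)
      have h6 := hs.le_end
      refine ⟨u, k, hu, rfl, ?_, h4.trans_le h6⟩
      simp only [Transmission.finish] at h5
      linarith
    -- Every slot lies inside its cycle, so simultaneous slots have the same cycle index.
    have hcycle {u w : V} {k l : ℕ} (hu1 : slotStart M N Q T par u k ≤ t)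
        (hw2 : t < slotStart M N Q T par w l + slotLength M N Q T par w) : k ≤ l := by
      by_contra! hlt
      have h1 := slotEnd_le_cycle (N := N) (Q := Q) (par := par) hM hT0.le w
      have h2 := slotStart_zero_nonneg (M := M) (N := N) (Q := Q) (par := par) hT0.le u
      rw [slotStart_eq] at hu1 hw2
      have h3 : ((l : ℝ) + 1) * (M.c₂ * T) ≤ k * (M.c₂ * T) :=
        mul_le_mul_of_nonneg_right (by exact_mod_cast hlt) (by positivity)
      linarith
    refine hM.colorPeriod_spec.2 _ ?_ ?_ ?_
    · intro a ha
      obtain ⟨u, k, hu, rfl, -, -⟩ := hmem ha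
      have := h.adj_par hu
      exact ⟨fun e => this.1 (N.pos_injective e), this.2⟩
    · intro a ha b hb
      obtain ⟨u, k, -, rfl, hu1, hu2⟩ := hmem ha
      obtain ⟨w, l, -, rfl, hw1, hw2⟩ := hmem hb
      obtain rfl := le_antisymm (hcycle hu1 hw2) (hcycle hw1 hu2)
      dsimp only
      have key {x y : V} (hx : slotStart M N Q T par x k ≤ t)
          (hy : t < slotStart M N Q T par y k + slotLength M N Q T par y) :
          InterferenceModel.regionColor M.colorPeriod (M.region (N.pos x)) ≤
            InterferenceModel.regionColor M.colorPeriod (M.region (N.pos y)) := by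
        rw [slotStart_eq] at hx hy
        have h1 := colorStart_le_slotStart (M := M) (N := N) (Q := Q) (par := par) hT0.le x
        have h2 := slotEnd_le_colorEnd (M := M) (N := N) (Q := Q) (par := par) hT0.le y
        have h3 := lt_of_mul_lt_mul_right (h1.trans_lt (lt_of_lt_of_le (by linarith) h2)) hT0.le
        exact Nat.lt_succ_iff.1 (by exact_mod_cast h3)
      exact le_antisymm (key hu1 hw2) (key hw1 hu2)
    · intro a ha b hb hab
      obtain ⟨u, k, -, rfl, hu1, hu2⟩ := hmem ha
      obtain ⟨w, l, -, rfl, hw1, hw2⟩ := hmem hb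
      obtain rfl := le_antisymm (hcycle hu1 hw2) (hcycle hw1 hu2)
      suffices e : u = w by rw [e]
      by_contra hne
      rw [slotStart_eq] at hu1 hu2 hw1 hw2
      rcases slots_disjoint (Q := Q) (par := par) hT0.le hne (fun _ => hab) with h1 | h1 <;>
        linarith

end Main

end WSN

theorem mainTheorem3 {V ι : Type*} [Fintype V] [LinearOrder V] [Fintype ι] [LinearOrder ι]
    (M : WSN.InterferenceModel) (hM : M.Valid)
    (N : WSN.Network V) (hconn : (N.graph M).Connected)
    (Q : ι → WSN.Query V)
    (T : ℝ) (hT0 : 0 < T) (hT : ∀ i, (Q i).p < T)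
    (hload : ∑ i, ((Q i).sources.card : ℝ) * (Q i).χ / (Q i).p ≤ 0.69 / (M.c₂ * M.c₃))
    (hdelay : ∀ i, 2 * M.c₂ * T * N.radius M ≤ (Q i).d) :
    (M.SafeColoring M.colorPeriod ∧
      (∀ ρ : ℝ, M = .prim ρ → M.c₂ = 4) ∧ (M = .rtscts → M.c₂ = 4)) ∧
    (∃ D par, WSN.IsCDSTree (N.graph M) N.sink D par) ∧
    (∀ D par, WSN.IsCDSTree (N.graph M) N.sink D par →
      WSN.AnswersAll M N Q (WSN.algorithmSchedule M N Q T par)) ∧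
    WSN.Schedulable M N Q := by
  have hans (D : Finset V) (par : V → V) (h : WSN.IsCDSTree (N.graph M) N.sink D par) :
      WSN.AnswersAll M N Q (WSN.algorithmSchedule M N Q T par) :=
    ⟨h.isSchedule hM hT0, h.meetsDeadlines hM hconn hT0 hT hload hdelay⟩
  have htree := WSN.exists_isCDSTree hconn N.sink
  refine ⟨⟨hM.colorPeriod_spec.2, ?_, ?_⟩, htree, hans, ?_⟩
  · rintro ρ rfl
    exact hM.c₂_eq_four (WSN.InterferenceModel.safeColoring_two_prim hM)
  · rintro rfl
    exact hM.c₂_eq_four WSN.InterferenceModel.safeColoring_two_rtscts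
  · obtain ⟨D, par, h⟩ := htree
    exact ⟨_, hans D par h⟩
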